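/- There exist absolute constants $c_0,\gamma,C_0>0$ such that the following holds for $\mathbb{K}=\mathbb{R}$ (real-valued model) and for $\mathbb{K}=\mathbb{C}$ (complex-valued model). Let $n\ge 1$ and $m$ be integers with $m\ge c_0\,n\log n$, fix $x\in\mathbb{K}^n$, and let $z_1,\dots,z_m$ be independent and uniformly distributed on the sphere of radius $\sqrt n$ in $\mathbb{K}^n$. Let $\mathcal{A}$ be the linear map from Hermitian matrices $X\in\mathbb{K}^{n\times n}$ (symmetric matrices if $\mathbb{K}=\mathbb{R}$) to $\mathbb{R}^m$ given by $\mathcal{A}(X)=(z_i^*Xz_i)_{1\le i\le m}$. With probability at least $1-3e^{-\gamma m/n}$, the following is true simultaneously for all $\varepsilon\ge 0$ and all $\nu\in\mathbb{R}^m$ with $\|\nu\|_2\le\varepsilon$. Put $b_i=|\langle x,z_i\rangle|^2+\nu_i$. Then the program $$\text{minimize }\operatorname{Tr}(X)\quad\text{subject to}\quad \|\mathcal{A}(X)-b\|_2\le\varepsilon,\quad X\succeq 0$$ has a solution, and every solution $\hat X$ satisfies $$\|\hat X-xx^*\|_F\le C_0\,\varepsilon .$$ Moreover, whenever $\hat X=\sum_{k=1}^n\hat\lambda_k\hat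 u_k\hat u_k^*$ with $\hat\lambda_1\ge\dots\ge\hat\lambda_n\ge0$ and $(\hat u_k)$ an orthonormal basis of $\mathbb{K}^n$, the vector $\hat x=\sqrt{\hat\lambda_1}\,\hat u_1$ satisfies $$\|\hat x-c\,x\|_2\le C_0\min\bigl(\|x\|_2,\ \varepsilon/\|x\|_2\bigr)$$ for some $c\in\mathbb{K}$ with $|c|=1$, that is, $c=e^{i\phi}$ with $\phi\in[0,2\pi]$ if $\mathbb{K}=\mathbb{C}$ and $c=\pm1$ if $\mathbb{K}=\mathbb{R}$ (for $x=0$ the minimum is read as $0$). -/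

import Mathlib

open MeasureTheory
open scoped ComplexOrder

noncomputable section

namespace PhaseLift

/- Everything is stated for a scalar field `𝕜` which is `ℝ` (real-valued model) or `ℂ`
(complex-valued model). -/

/-- The uniform probability distribution on the sphere of radius `√n` of `𝕜ⁿ` (for `1 ≤ n`):
the surface measure of the Euclidean unit sphere, normalized to total mass one and pushed
forward under `u ↦ √n u`. -/
def uniformSphere (𝕜 : Type*) [RCLike 𝕜] (n : ℕ) : Measure (EuclideanSpace 𝕜 (Fin n)) :=
  Measure.map
    (fun u : Metric.sphere (0 : EuclideanSpace 𝕜 (Fin n)) 1 =>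
      Real.sqrt n • (u : EuclideanSpace 𝕜 (Fin n)))
    (((Measure.addHaar : Measure (EuclideanSpace 𝕜 (Fin n))).toSphere Set.univ)⁻¹ •
      (Measure.addHaar : Measure (EuclideanSpace 𝕜 (Fin n))).toSphere)

/-- The joint law of `m` independent vectors, each uniform on the sphere of radius `√n`. -/
def sensingLaw (𝕜 : Type*) [RCLike 𝕜] (n m : ℕ) :
    Measure (Fin m → EuclideanSpace 𝕜 (Fin n)) :=
  Measure.pi fun _ => uniformSphere 𝕜 n

section

variable {𝕜 : Type*} [RCLike 𝕜] {n m : ℕ}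

/-- The rank-one matrix `v v^*`. -/
def outer (v : EuclideanSpace 𝕜 (Fin n)) : Matrix (Fin n) (Fin n) 𝕜 :=
  Matrix.vecMulVec v.ofLp (star v.ofLp)

/-- The Frobenius norm of a matrix. -/
def frobeniusNorm (X : Matrix (Fin n) (Fin n) 𝕜) : ℝ :=
  Real.sqrt (∑ i, ∑ j, ‖X i j‖ ^ 2)

/-- The measurement map `X ↦ (z_i^* X z_i)_i`; for Hermitian `X` each `z_i^* X z_i` is real, so
that taking the real part changes nothing. -/
def measure (z : Fin m → EuclideanSpace 𝕜 (Fin n)) (X : Matrix (Fin n) (Fin n) 𝕜) :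
    EuclideanSpace ℝ (Fin m) :=
  WithLp.toLp 2 fun i => RCLike.re (dotProduct (star (z i).ofLp) (X.mulVec (z i).ofLp))

/-- The noisy data `b_i = |⟨x, z_i⟩|² + ν_i`. -/
def noisyData (z : Fin m → EuclideanSpace 𝕜 (Fin n)) (x : EuclideanSpace 𝕜 (Fin n))
    (ν : EuclideanSpace ℝ (Fin m)) : EuclideanSpace ℝ (Fin m) :=
  WithLp.toLp 2 fun i => ‖inner 𝕜 x (z i)‖ ^ 2 + ν i

/-- Feasibility for the relaxed program: `X ⪰ 0` (in particular `X` is Hermitian) and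
`‖𝒜(X) - b‖₂ ≤ ε`. -/
def IsFeasible (z : Fin m → EuclideanSpace 𝕜 (Fin n)) (b : EuclideanSpace ℝ (Fin m)) (ε : ℝ)
    (X : Matrix (Fin n) (Fin n) 𝕜) : Prop :=
  X.PosSemidef ∧ ‖measure z X - b‖ ≤ ε

/-- `X` is a solution of: minimize `Tr X` subject to `‖𝒜(X) - b‖₂ ≤ ε` and `X ⪰ 0`. -/
def IsSolution (z : Fin m → EuclideanSpace 𝕜 (Fin n)) (b : EuclideanSpace ℝ (Fin m)) (ε : ℝ)
    (X : Matrix (Fin n) (Fin n) 𝕜) : Prop :=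
  IsFeasible z b ε X ∧
    ∀ Y : Matrix (Fin n) (Fin n) 𝕜, IsFeasible z b ε Y → RCLike.re X.trace ≤ RCLike.re Y.trace

/-- `v` is obtained by extracting the largest rank-one component of `X`: for some spectral
decomposition `X = ∑ k, lam k • u k (u k)^*` with `u` an orthonormal basis and
`lam 0 ≥ lam 1 ≥ … ≥ 0`, one has `v = √(lam 0) • u 0`. -/
def IsTopComponent (X : Matrix (Fin n) (Fin n) 𝕜) (v : EuclideanSpace 𝕜 (Fin n)) : Prop :=
  ∃ (u : OrthonormalBasis (Fin n) 𝕜 (EuclideanSpace 𝕜 (Fin n))) (lam : Fin n → ℝ),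
    Antitone lam ∧ (∀ k, 0 ≤ lam k) ∧
    X = ∑ k, ((lam k : ℝ) : 𝕜) • outer (u k) ∧
    ∃ k₀ : Fin n, (k₀ : ℕ) = 0 ∧ v = ((Real.sqrt (lam k₀) : ℝ) : 𝕜) • u k₀

/-- Stable recovery of `x` from the sensing vectors `z` with constant `C₀`: for all noise vectors
`ν` and all levels `ε` with `‖ν‖₂ ≤ ε`, the relaxed program has a solution, every solution `X`
is within Frobenius distance `C₀ ε` of `x x^*`, and its largest rank-one component `v` is within
`C₀ min (‖x‖₂, ε / ‖x‖₂)` of `c x` for some scalar `c` of modulus one (that is, `c = e^{iφ}` over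
`ℂ`, and `c = ±1` over `ℝ`). If `x = 0`, the minimum is `0`. -/
def StableRecovery (C₀ : ℝ) (z : Fin m → EuclideanSpace 𝕜 (Fin n))
    (x : EuclideanSpace 𝕜 (Fin n)) : Prop :=
  ∀ (ε : ℝ) (ν : EuclideanSpace ℝ (Fin m)), ‖ν‖ ≤ ε →
    (∃ X : Matrix (Fin n) (Fin n) 𝕜, IsSolution z (noisyData z x ν) ε X) ∧
    ∀ X : Matrix (Fin n) (Fin n) 𝕜, IsSolution z (noisyData z x ν) ε X →
      frobeniusNorm (X - outer x) ≤ C₀ * ε ∧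
      ∀ v : EuclideanSpace 𝕜 (Fin n), IsTopComponent X v →
        ∃ c : 𝕜, ‖c‖ = 1 ∧ ‖v - c • x‖ ≤ C₀ * min ‖x‖ (ε / ‖x‖)

end

/-- The property `P` holds with probability at least `p` under `μ`: it holds on a measurable
event of probability at least `p`. -/
def HoldsWithProbAtLeast {Ω : Type*} [MeasurableSpace Ω] (μ : Measure Ω) (p : ℝ)
    (P : Ω → Prop) : Prop :=
  ∃ E : Set Ω, MeasurableSet E ∧ (∀ ω ∈ E, P ω) ∧ ENNReal.ofReal p ≤ μ E

end PhaseLift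

end

/-! Write x = r e with ‖e‖ = 1. Since x x^* is feasible, a solution X has trace at most ‖x‖², and
positivity lets one split H = X - x x^* as -s e e^* + (e v^* + v e^*) + ∑ w_k w_k^* with v and all
w_k orthogonal to e and ∑ ‖w_k‖² ≤ s (`exists_block_decomposition`). Hence ‖H‖_F ≤ 2 s + 2 ‖v‖, and
it remains to bound s and ‖v‖ by Q = ∑ |z_i^* H z_i|.

Put g_i = |⟨e, z_i⟩|². Averaging z_i^* H z_i with the bounded weights g_i / (1 + g_i) gives about -a
s + b ∑ ‖w_k‖² ≤ -(a - b) s: the cross term averages to zero, and a > b because the weight increases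
with g_i. So m s is at most a multiple of Q plus a tiny multiple of m ‖v‖. Without weights, the mean
modulus of the cross term is at least a constant times ‖v‖, so m ‖v‖ is at most a multiple of Q + m
s. The two bounds close up (`frobeniusNorm_le_of_isRegularSample`). The weighted sum of the z_i
z_i^* acts as an approximate dual certificate.

The averages needed (`IsRegularSample`) run over single directions orthogonal to a fixed e. Chernoff
bounds on an exponentially large net therefore suffice once m ≥ K n (`exists_isRegularSample`); for
m < K n the claimed probability is not positive. Cap estimates and unitary invariance supply moments
with absolute constants, the same over ℝ and ℂ.

For the vector estimate, the trace bound forces the eigenvalues of X below the largest to have sum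
at most ‖H‖_F (`exists_phase_of_isTopComponent`). -/

noncomputable section

namespace PhaseLift

/-! ### Nets in the unit ball by volume comparison. -/

section Nets

open Metric Module

/-- A `δ`-separated finite subset of the unit ball of a `d`-dimensional real normed space has at
most `(1 + 2 / δ) ^ d` elements. -/
theorem card_le_of_separated {F : Type*} [NormedAddCommGroup F] [NormedSpace ℝ F]
    [FiniteDimensional ℝ F] {δ : ℝ} (hδ : 0 < δ) (s : Finset F) (hs : ∀ c ∈ s, ‖c‖ ≤ 1)
    (h : ∀ c ∈ s, ∀ d ∈ s, c ≠ d → δ ≤ ‖c - d‖) :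
    (s.card : ℝ) ≤ (1 + 2 / δ) ^ finrank ℝ F := by
  borelize F
  let μ : Measure F := Measure.addHaar
  have hr : 0 < δ / 2 := by positivity
  have hR : 0 < 1 + δ / 2 := by positivity
  -- Volume comparison: the balls of radius δ/2 about the points are disjoint and lie in the ball of
  -- radius 1 + δ/2.
  have D : Set.Pairwise (s : Set F) (Function.onFun Disjoint fun c => ball (c : F) (δ / 2)) := by
    rintro c hc d hd hcd
    apply ball_disjoint_ball
    rw [dist_eq_norm]
    linarith [h c hc d hd hcd]
  have hsub : (⋃ c ∈ s, ball (c : F) (δ / 2)) ⊆ ball (0 : F) (1 + δ / 2) := by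
    refine Set.iUnion₂_subset fun x hx => ball_subset_ball' ?_
    rw [dist_zero_right]
    linarith [hs x hx]
  have I : (s.card : ENNReal) * ENNReal.ofReal ((δ / 2) ^ finrank ℝ F) * μ (ball 0 1) ≤
      ENNReal.ofReal ((1 + δ / 2) ^ finrank ℝ F) * μ (ball 0 1) := by
    calc
      _ = μ (⋃ c ∈ s, ball (c : F) (δ / 2)) := by
        rw [measure_biUnion_finset D fun c _ => measurableSet_ball]
        simp only [μ.addHaar_ball_of_pos _ hr]
        simp only [Finset.sum_const, nsmul_eq_mul, mul_assoc]
      _ ≤ μ (ball (0 : F) (1 + δ / 2)) := measure_mono hsub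
      _ = _ := μ.addHaar_ball_of_pos _ hR
  have J : (s.card : ENNReal) * ENNReal.ofReal ((δ / 2) ^ finrank ℝ F) ≤
      ENNReal.ofReal ((1 + δ / 2) ^ finrank ℝ F) :=
    (ENNReal.mul_le_mul_iff_left (measure_ball_pos _ _ zero_lt_one).ne' measure_ball_lt_top.ne).1 I
  have K := ENNReal.toReal_le_of_le_ofReal (pow_nonneg hR.le _) J
  rw [ENNReal.toReal_mul, ENNReal.toReal_natCast, ENNReal.toReal_ofReal (by positivity)] at K
  have : 1 + 2 / δ = (1 + δ / 2) / (δ / 2) := by field_simp; ring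
  rw [this, div_pow, le_div_iff₀ (by positivity)]
  exact K

/-- Every subset `A` of the unit ball of a `d`-dimensional real normed space contains a finite
`δ`-net of `A` with at most `(1 + 2 / δ) ^ d` elements. -/
theorem exists_finset_net {F : Type*} [NormedAddCommGroup F] [NormedSpace ℝ F]
    [FiniteDimensional ℝ F] {δ : ℝ} (hδ : 0 < δ) (A : Set F) (hA : ∀ c ∈ A, ‖c‖ ≤ 1) :
    ∃ N : Finset F, (∀ p ∈ N, p ∈ A) ∧ (N.card : ℝ) ≤ (1 + 2 / δ) ^ finrank ℝ F ∧
      ∀ u ∈ A, ∃ p ∈ N, ‖u - p‖ ≤ δ := by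
  classical
  -- A δ-separated subset of `A` of largest cardinality is a δ-net, since a point at distance more
  -- than δ from it could be added. The volume bound makes the largest cardinality exist.
  let P : ℕ → Prop := fun k => ∃ N : Finset F, N.card = k ∧ (∀ p ∈ N, p ∈ A) ∧
    ∀ c ∈ N, ∀ d ∈ N, c ≠ d → δ ≤ ‖c - d‖
  have hbound : ∀ k, P k → k ≤ ⌊(1 + 2 / δ) ^ finrank ℝ F⌋₊ := by
    rintro k ⟨N, rfl, h1, h2⟩
    exact Nat.le_floor (card_le_of_separated hδ N (fun c hc => hA c (h1 c hc)) h2)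
  have h0 : P 0 := ⟨∅, by simp⟩
  obtain ⟨N, hNc, hNA, hNs⟩ := Nat.findGreatest_spec (P := P) (Nat.zero_le _) h0
  refine ⟨N, hNA, card_le_of_separated hδ N (fun c hc => hA c (hNA c hc)) hNs, fun u hu => ?_⟩
  by_contra! hcon
  have huN : u ∉ N := fun hmem => by
    have := hcon u hmem
    simp at this
    linarith
  have hP : P (N.card + 1) := by
    refine ⟨insert u N, Finset.card_insert_of_notMem huN, ?_, ?_⟩
    · intro p hp
      rcases Finset.mem_insert.1 hp with rfl | hp
      exacts [hu, hNA p hp]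
    · intro c hc d hd hcd
      rcases Finset.mem_insert.1 hc with hc | hc <;> rcases Finset.mem_insert.1 hd with hd | hd
      · exact absurd (hc.trans hd.symm) hcd
      · exact hc ▸ (hcon d hd).le
      · rw [norm_sub_rev]; exact hd ▸ (hcon c hc).le
      · exact hNs c hc d hd hcd
  have h := Nat.le_findGreatest (hbound _ hP) hP
  exact absurd (h.trans_eq hNc.symm) (Nat.not_succ_le_self _)

end Nets

/-! ### Chernoff bounds from one exponential moment. -/

section Chernoff

/-- A second-order Taylor bound valid on the whole line; the exponential factor in the remainder is
later absorbed by the exponential moment. -/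
theorem exp_le_one_add_add_sq_mul_exp_abs (x : ℝ) :
    Real.exp x ≤ 1 + x + x ^ 2 * Real.exp |x| := by
  have h1 : (1 : ℝ) ≤ Real.exp |x| := Real.one_le_exp (abs_nonneg x)
  rcases le_total |x| 1 with h | h
  · have := Real.abs_exp_sub_one_sub_id_le h
    nlinarith [abs_le.1 this, sq_nonneg x]
  · rcases le_total 0 x with hx | hx
    · rw [abs_of_nonneg hx] at *
      have hx2 : 1 ≤ x ^ 2 := one_le_pow₀ h
      nlinarith
    · rw [abs_of_nonpos hx] at *
      have : Real.exp x ≤ 1 := Real.exp_le_one_iff.2 hx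
      nlinarith [sq_nonneg x]

/-- Only half of the exponent s is spent on the square; the other half pays for the factor exp |l Y|
with l ≤ s / 2. -/
theorem sq_le_mul_exp {s : ℝ} (hs : 0 < s) {y : ℝ} (hy : 0 ≤ y) :
    y ^ 2 ≤ 8 / s ^ 2 * Real.exp (s / 2 * y) := by
  have h := Real.quadratic_le_exp_of_nonneg (x := s / 2 * y) (by positivity)
  have h2 : s ^ 2 / 8 * y ^ 2 ≤ Real.exp (s / 2 * y) := by nlinarith [mul_nonneg hs.le hy]
  calc y ^ 2 = 8 / s ^ 2 * (s ^ 2 / 8 * y ^ 2) := by field_simp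
    _ ≤ _ := by gcongr

variable {Ω : Type*} [MeasurableSpace Ω] {μ : Measure Ω}

theorem integrable_of_integrable_exp_abs {s : ℝ} (hs : 0 < s) {Y : Ω → ℝ} (hY : Measurable Y)
    (hint : Integrable (fun ω => Real.exp (s * |Y ω|)) μ) : Integrable Y μ := by
  refine (hint.const_mul s⁻¹).mono' hY.aestronglyMeasurable (ae_of_all _ fun ω => ?_)
  have := Real.add_one_le_exp (s * |Y ω|)
  rw [Real.norm_eq_abs, inv_mul_eq_div, le_div_iff₀ hs]
  linarith

/-- The moment generating function of a variable with an exponential moment, near the origin. -/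
theorem integral_exp_mul_le [IsProbabilityMeasure μ] {s C l : ℝ} (hs : 0 < s) {Y : Ω → ℝ}
    (hY : Measurable Y)
    (hint : Integrable (fun ω => Real.exp (s * |Y ω|)) μ)
    (hC : ∫ ω, Real.exp (s * |Y ω|) ∂μ ≤ C) (hl : 0 ≤ l) (hls : l ≤ s / 2) :
    Integrable (fun ω => Real.exp (l * Y ω)) μ ∧
    ∫ ω, Real.exp (l * Y ω) ∂μ ≤ Real.exp (l * ∫ ω, Y ω ∂μ + l ^ 2 * (8 / s ^ 2 * C)) := by
  have hYi := integrable_of_integrable_exp_abs hs hY hint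
  have hexp : Integrable (fun ω => Real.exp (l * Y ω)) μ := by
    refine hint.mono' (by fun_prop) (ae_of_all _ fun ω => ?_)
    rw [Real.norm_eq_abs, Real.abs_exp]
    refine Real.exp_le_exp.2 ?_
    nlinarith [le_abs_self (Y ω), abs_nonneg (Y ω)]
  refine ⟨hexp, ?_⟩
  have hpt : ∀ ω, Real.exp (l * Y ω) ≤
      1 + l * Y ω + l ^ 2 * (8 / s ^ 2) * Real.exp (s * |Y ω|) := by
    intro ω
    refine (exp_le_one_add_add_sq_mul_exp_abs _).trans ?_
    have h1 : (l * Y ω) ^ 2 * Real.exp |l * Y ω| ≤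
        l ^ 2 * (8 / s ^ 2) * Real.exp (s * |Y ω|) := by
      have e1 : |l * Y ω| ≤ s / 2 * |Y ω| := by
        rw [abs_mul, abs_of_nonneg hl]
        gcongr
      have e2 := sq_le_mul_exp hs (abs_nonneg (Y ω))
      rw [sq_abs] at e2
      calc (l * Y ω) ^ 2 * Real.exp |l * Y ω|
          ≤ l ^ 2 * (8 / s ^ 2 * Real.exp (s / 2 * |Y ω|)) * Real.exp (s / 2 * |Y ω|) := by
            rw [mul_pow]
            gcongr
        _ = l ^ 2 * (8 / s ^ 2) * (Real.exp (s / 2 * |Y ω|) * Real.exp (s / 2 * |Y ω|)) := by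
            ring
        _ = _ := by
            rw [← Real.exp_add]
            ring_nf
    linarith
  have i1 : Integrable (fun ω => 1 + l * Y ω) μ := (integrable_const _).add (hYi.const_mul l)
  calc ∫ ω, Real.exp (l * Y ω) ∂μ
      ≤ ∫ ω, (1 + l * Y ω + l ^ 2 * (8 / s ^ 2) * Real.exp (s * |Y ω|)) ∂μ :=
        integral_mono hexp (i1.add (hint.const_mul _)) hpt
    _ = 1 + l * ∫ ω, Y ω ∂μ + l ^ 2 * (8 / s ^ 2) * ∫ ω, Real.exp (s * |Y ω|) ∂μ := by
        rw [integral_add i1 (hint.const_mul _), integral_add (integrable_const _) (hYi.const_mul l),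
          integral_const_mul, integral_const_mul]
        simp
    _ ≤ 1 + (l * ∫ ω, Y ω ∂μ + l ^ 2 * (8 / s ^ 2 * C)) := by
        have : l ^ 2 * (8 / s ^ 2) * ∫ ω, Real.exp (s * |Y ω|) ∂μ ≤ l ^ 2 * (8 / s ^ 2) * C := by
          gcongr
        linarith
    _ ≤ _ := by
        rw [add_comm]
        exact Real.add_one_le_exp _

/-- **Chernoff bound**: the upper deviation of an empirical mean of a variable with an exponential
moment. -/
theorem exists_chernoff_rate {s C η : ℝ} (hs : 0 < s) (hC : 0 < C) (hη : 0 < η) :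
    ∃ c : ℝ, 0 < c ∧ ∀ (Ω : Type) [MeasurableSpace Ω] (μ : Measure Ω) [IsProbabilityMeasure μ]
      (Y : Ω → ℝ), Measurable Y → Integrable (fun ω => Real.exp (s * |Y ω|)) μ →
      ∫ ω, Real.exp (s * |Y ω|) ∂μ ≤ C → ∀ (M : ℝ), ∫ ω, Y ω ∂μ ≤ M → ∀ m : ℕ,
      (Measure.pi fun _ : Fin m => μ) {z | m * (M + η) ≤ ∑ i, Y (z i)} ≤
        ENNReal.ofReal (Real.exp (-(c * m))) := by
  -- The logarithm of the moment generating function at l is at most l E[Y] + l² K. With l K ≤ η /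
  -- 2, Markov's inequality leaves the exponent -l η m / 2. The rate depends on s, C and η only,
  -- hence is uniform in dimension and field.
  set K : ℝ := 8 / s ^ 2 * C with hK
  have hKpos : 0 < K := by positivity
  set l : ℝ := min (s / 2) (η / (2 * K)) with hl
  have hlpos : 0 < l := by positivity
  have hls : l ≤ s / 2 := min_le_left _ _
  have hlη : l * K ≤ η / 2 := by
    have : l ≤ η / (2 * K) := min_le_right _ _
    rw [le_div_iff₀ (by positivity)] at this
    linarith
  refine ⟨l * η / 2, by positivity, fun Ω _ μ _ Y hY hint hC' M hM m => ?_⟩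
  obtain ⟨hexp, hle⟩ := integral_exp_mul_le hs hY hint hC' hlpos.le hls
  set S : Set (Fin m → Ω) := {z | m * (M + η) ≤ ∑ i, Y (z i)} with hS
  have hfm : Measurable fun z : Fin m → Ω => ∏ i, Real.exp (l * Y (z i)) := by fun_prop
  have hfi : Integrable (fun z : Fin m → Ω => ∏ i, Real.exp (l * Y (z i)))
      (Measure.pi fun _ : Fin m => μ) := Integrable.fintype_prod fun _ => hexp
  have hint_eq : ∫ z : Fin m → Ω, ∏ i, Real.exp (l * Y (z i)) ∂(Measure.pi fun _ : Fin m => μ) =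
      (∫ ω, Real.exp (l * Y ω) ∂μ) ^ m := by
    rw [integral_fintype_prod_eq_pow (fun ω => Real.exp (l * Y ω)), Fintype.card_fin]
  have hmarkov := mul_meas_ge_le_integral_of_nonneg (ae_of_all _ fun z =>
    Finset.prod_nonneg fun i _ => (Real.exp_pos (l * Y (z i))).le) hfi
      (Real.exp (l * (m * (M + η))))
  have hSsub : S ⊆ {z | Real.exp (l * (m * (M + η))) ≤ ∏ i, Real.exp (l * Y (z i))} := by
    intro z hz
    simp only [Set.mem_ofPred_eq, ← Real.exp_sum, ← Finset.mul_sum]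
    exact Real.exp_le_exp.2 (mul_le_mul_of_nonneg_left hz hlpos.le)
  have hreal : (Measure.pi fun _ : Fin m => μ).real
      {z | Real.exp (l * (m * (M + η))) ≤ ∏ i, Real.exp (l * Y (z i))} ≤
      Real.exp (-(l * η / 2 * m)) := by
    rw [← mul_le_mul_iff_right₀ (Real.exp_pos (l * (m * (M + η))))]
    refine hmarkov.trans ?_
    rw [hint_eq, ← Real.exp_add]
    calc (∫ ω, Real.exp (l * Y ω) ∂μ) ^ m ≤ (Real.exp (l * ∫ ω, Y ω ∂μ + l ^ 2 * K)) ^ m := by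
          gcongr
      _ = Real.exp (m * (l * ∫ ω, Y ω ∂μ + l ^ 2 * K)) := by rw [← Real.exp_nat_mul]
      _ ≤ _ := by
          refine Real.exp_le_exp.2 ?_
          have h1 : l * ∫ ω, Y ω ∂μ ≤ l * M := by gcongr
          have h2 : l ^ 2 * K ≤ l * (η / 2) := by nlinarith
          have : (m : ℝ) * (l * ∫ ω, Y ω ∂μ + l ^ 2 * K) ≤ m * (l * M + l * (η / 2)) := by
            gcongr
          linarith
  refine (measure_mono hSsub).trans ?_
  rw [← ENNReal.ofReal_toReal (measure_ne_top (Measure.pi fun _ : Fin m => μ) _)]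
  exact ENNReal.ofReal_le_ofReal hreal

end Chernoff

/-! ### The uniform law on the sphere: invariance and caps. -/

section Sphere

open Metric Module
open scoped Pointwise

variable {𝕜 : Type} [RCLike 𝕜] {n : ℕ}

theorem le_finrank_real : n ≤ finrank ℝ (EuclideanSpace 𝕜 (Fin n)) := by
  have h := finrank_mul_finrank ℝ 𝕜 (EuclideanSpace 𝕜 (Fin n))
  rw [finrank_euclideanSpace_fin] at h
  rw [← h]
  exact Nat.le_mul_of_pos_left _ finrank_pos

theorem finrank_real_le : finrank ℝ (EuclideanSpace 𝕜 (Fin n)) ≤ 2 * n := by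
  have h := finrank_mul_finrank ℝ 𝕜 (EuclideanSpace 𝕜 (Fin n))
  rw [finrank_euclideanSpace_fin] at h
  rw [← h]
  exact Nat.mul_le_mul_right _ (RCLike.finrank_le_two 𝕜)

/-- The uniform distribution on the sphere is the radial projection of the uniform distribution on
the unit ball. -/
theorem uniformSphere_apply (hn : 1 ≤ n) {S : Set (EuclideanSpace 𝕜 (Fin n))}
    (hS : MeasurableSet S) :
    uniformSphere 𝕜 n S = (Measure.addHaar (ball (0 : EuclideanSpace 𝕜 (Fin n)) 1))⁻¹ *
      Measure.addHaar (ball (0 : EuclideanSpace 𝕜 (Fin n)) 1 ∩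
        {y | Real.sqrt n • (‖y‖⁻¹ • y) ∈ S}) := by
  have hd : finrank ℝ (EuclideanSpace 𝕜 (Fin n)) ≠ 0 := by
    have := le_finrank_real (𝕜 := 𝕜) (n := n)
    omega
  have hnt : Nontrivial (EuclideanSpace 𝕜 (Fin n)) :=
    Module.nontrivial_of_finrank_pos (R := ℝ) (Nat.pos_of_ne_zero hd)
  have hmeas : Measurable fun u : sphere (0 : EuclideanSpace 𝕜 (Fin n)) 1 =>
      Real.sqrt n • (u : EuclideanSpace 𝕜 (Fin n)) := by fun_prop
  rw [uniformSphere, Measure.map_apply hmeas hS, Measure.smul_apply,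
    Measure.toSphere_apply_univ, Measure.toSphere_apply' _ (hmeas hS), smul_eq_mul]
  -- The open cone omits the origin, whereas at `y = 0` the radial projection takes the default
  -- value 0, which may lie in `S`. The discrepancy is the null set `{0}`; the dimension factor of
  -- `toSphere` cancels afterwards.
  have hset : Set.Ioo (0 : ℝ) 1 • ((↑) '' ((fun u : sphere (0 : EuclideanSpace 𝕜 (Fin n)) 1 =>
      Real.sqrt n • (u : EuclideanSpace 𝕜 (Fin n))) ⁻¹' S)) =
      (ball (0 : EuclideanSpace 𝕜 (Fin n)) 1 ∩ {y | Real.sqrt n • (‖y‖⁻¹ • y) ∈ S}) \ {0} := by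
    ext y
    rw [Set.mem_smul]
    constructor
    · rintro ⟨r, hr, _, ⟨u, hu, rfl⟩, rfl⟩
      have hu1 : ‖(u : EuclideanSpace 𝕜 (Fin n))‖ = 1 := by simp
      have hnorm : ‖r • (u : EuclideanSpace 𝕜 (Fin n))‖ = r := by
        rw [norm_smul, hu1, mul_one, Real.norm_of_nonneg hr.1.le]
      refine ⟨⟨?_, ?_⟩, ?_⟩
      · simpa [hnorm] using hr.2
      · have e : ‖r • (u : EuclideanSpace 𝕜 (Fin n))‖⁻¹ • r • (u : EuclideanSpace 𝕜 (Fin n)) =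
            u := by
          rw [hnorm, smul_smul, inv_mul_cancel₀ hr.1.ne', one_smul]
        change Real.sqrt n • (‖r • (u : EuclideanSpace 𝕜 (Fin n))‖⁻¹ • _) ∈ S
        rw [e]
        exact hu
      · intro h0
        rw [Set.mem_singleton_iff] at h0
        rw [h0, norm_zero] at hnorm
        exact hr.1.ne hnorm
    · rintro ⟨⟨hy1, hy2⟩, hy0⟩
      have hy0' : 0 < ‖y‖ := norm_pos_iff.2 hy0
      refine ⟨‖y‖, ⟨hy0', by simpa using hy1⟩, ‖y‖⁻¹ • y, ⟨⟨‖y‖⁻¹ • y, ?_⟩, hy2, rfl⟩, ?_⟩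
      · simp [norm_smul, hy0'.ne']
      · simp [smul_smul, hy0'.ne']
  rw [hset, measure_sdiff_null (measure_singleton _), mul_comm _⁻¹, mul_comm _⁻¹,
    ← div_eq_mul_inv, ← div_eq_mul_inv,
    ENNReal.mul_div_mul_left _ _ (Nat.cast_ne_zero.2 hd) (ENNReal.natCast_ne_top _)]

theorem isProbabilityMeasure_uniformSphere (hn : 1 ≤ n) :
    IsProbabilityMeasure (uniformSphere 𝕜 n) := by
  refine ⟨?_⟩
  rw [uniformSphere_apply hn MeasurableSet.univ]
  simp only [Set.mem_univ, Set.ofPred_true, Set.inter_univ]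
  exact ENNReal.inv_mul_cancel (measure_ball_pos _ _ one_pos).ne' measure_ball_lt_top.ne

theorem ae_norm_eq_sqrt : ∀ᵐ z ∂(uniformSphere 𝕜 n), ‖z‖ = Real.sqrt n := by
  have hmeas : Measurable fun u : sphere (0 : EuclideanSpace 𝕜 (Fin n)) 1 =>
      Real.sqrt n • (u : EuclideanSpace 𝕜 (Fin n)) := by fun_prop
  rw [uniformSphere, ae_map_iff hmeas.aemeasurable
    (measurableSet_eq_fun measurable_norm measurable_const)]
  refine ae_of_all _ fun u => ?_
  rw [norm_smul, norm_eq_of_mem_sphere, mul_one, Real.norm_of_nonneg (Real.sqrt_nonneg _)]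

/-- A real-linear map multiplies volume by a constant determinant factor, and this factor is 1
because the unit ball is preserved and has finite positive volume. -/
theorem addHaar_preimage_linearIsometryEquiv
    (U : EuclideanSpace 𝕜 (Fin n) ≃ₗᵢ[𝕜] EuclideanSpace 𝕜 (Fin n))
    (s : Set (EuclideanSpace 𝕜 (Fin n))) :
    (Measure.addHaar : Measure (EuclideanSpace 𝕜 (Fin n))) (U ⁻¹' s) = Measure.addHaar s := by
  set f : EuclideanSpace 𝕜 (Fin n) ≃ₗ[ℝ] EuclideanSpace 𝕜 (Fin n) :=
    U.toLinearEquiv.restrictScalars ℝ with hf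
  have hfU : ∀ s : Set (EuclideanSpace 𝕜 (Fin n)), U ⁻¹' s = f ⁻¹' s := fun s => rfl
  have h1 := Measure.addHaar_preimage_linearEquiv
    (Measure.addHaar : Measure (EuclideanSpace 𝕜 (Fin n))) f (ball 0 1)
  have hball : f ⁻¹' (ball (0 : EuclideanSpace 𝕜 (Fin n)) 1) = ball 0 1 := by
    ext y
    have : ‖f y‖ = ‖y‖ := U.norm_map y
    simp [this]
  rw [hball] at h1
  have h2 : ENNReal.ofReal |LinearMap.det (f.symm : EuclideanSpace 𝕜 (Fin n) →ₗ[ℝ]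
      EuclideanSpace 𝕜 (Fin n))| = 1 := by
    have hpos := (measure_ball_pos (Measure.addHaar : Measure (EuclideanSpace 𝕜 (Fin n))) 0
      one_pos).ne'
    have htop := (measure_ball_lt_top (μ := (Measure.addHaar :
      Measure (EuclideanSpace 𝕜 (Fin n)))) (x := 0) (r := 1)).ne
    rw [← ENNReal.mul_left_inj hpos htop, one_mul]
    exact h1.symm
  rw [hfU, Measure.addHaar_preimage_linearEquiv, h2, one_mul]

/-- The uniform distribution on the sphere is invariant under unitary maps. -/
theorem measurePreserving_uniformSphere (hn : 1 ≤ n)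
    (U : EuclideanSpace 𝕜 (Fin n) ≃ₗᵢ[𝕜] EuclideanSpace 𝕜 (Fin n)) :
    MeasurePreserving U (uniformSphere 𝕜 n) (uniformSphere 𝕜 n) := by
  have hU : Measurable U := U.continuous.measurable
  refine ⟨hU, Measure.ext fun S hS => ?_⟩
  rw [Measure.map_apply hU hS, uniformSphere_apply hn (hU hS), uniformSphere_apply hn hS]
  congr 1
  rw [← addHaar_preimage_linearIsometryEquiv U (ball 0 1 ∩ {y | Real.sqrt n • (‖y‖⁻¹ • y) ∈ S})]
  congr 1
  ext y
  have h (r : ℝ) (y : EuclideanSpace 𝕜 (Fin n)) : U (r • y) = r • U y :=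
    (U.toLinearEquiv.restrictScalars ℝ).map_smul r y
  simp [h]

/-- Caps of the sphere have exponentially small measure: the cone over a cap is contained in a
small ball. -/
theorem uniformSphere_cap_le (hn : 1 ≤ n) {u : EuclideanSpace 𝕜 (Fin n)} (hu : ‖u‖ ≤ 1)
    {t : ℝ} (ht0 : 0 ≤ t) (ht1 : t ≤ 1) :
    uniformSphere 𝕜 n {z | t * Real.sqrt n ≤ RCLike.re (inner 𝕜 u z)} ≤
      ENNReal.ofReal (Real.exp (-(3 / 8 * n * t ^ 2))) := by
  have hS : MeasurableSet {z : EuclideanSpace 𝕜 (Fin n) |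
      t * Real.sqrt n ≤ RCLike.re (inner 𝕜 u z)} :=
    measurableSet_le measurable_const
      (RCLike.continuous_re.comp (continuous_const.inner continuous_id)).measurable
  have hV0 := (measure_ball_pos (Measure.addHaar : Measure (EuclideanSpace 𝕜 (Fin n))) 0
    one_pos).ne'
  have hVt := (measure_ball_lt_top (μ := (Measure.addHaar :
    Measure (EuclideanSpace 𝕜 (Fin n)))) (x := 0) (r := 1)).ne
  have hnpos : 0 < Real.sqrt n := Real.sqrt_pos.2 (by exact_mod_cast hn)
  have ht2 : t ^ 2 ≤ 1 := pow_le_one₀ ht0 ht1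
  -- For ‖y‖ ≤ 1 and Re⟨u, y⟩ ≥ t ‖y‖ one gets ‖y - (t/2) u‖² ≤ ‖y‖² - t² ‖y‖ + t²/4 ≤ 1 - 3t²/4,
  -- using t ≤ 1. The relative volume of this ball is r to the real dimension, with r ≤ exp(-3t²/8).
  set r : ℝ := Real.sqrt (1 - 3 / 4 * t ^ 2) with hr
  have hrpos : 0 < r := Real.sqrt_pos.2 (by linarith)
  have hr2 : r ^ 2 = 1 - 3 / 4 * t ^ 2 := Real.sq_sqrt (by linarith)
  have hsub : ball (0 : EuclideanSpace 𝕜 (Fin n)) 1 ∩ {y | Real.sqrt n • (‖y‖⁻¹ • y) ∈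
      {z : EuclideanSpace 𝕜 (Fin n) | t * Real.sqrt n ≤ RCLike.re (inner 𝕜 u z)}} ⊆
      closedBall (((t / 2 : ℝ) : 𝕜) • u) r := by
    rintro y ⟨hy1, hy2⟩
    have hy1' : ‖y‖ < 1 := by simpa using hy1
    have hy3 : t * ‖y‖ ≤ RCLike.re (inner 𝕜 u y) := by
      rcases eq_or_ne y 0 with rfl | hy0
      · simp
      have hy0' : 0 < ‖y‖ := norm_pos_iff.2 hy0
      have hy2' : t * Real.sqrt n ≤ RCLike.re (inner 𝕜 u (Real.sqrt n • (‖y‖⁻¹ • y))) := hy2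
      rw [RCLike.real_smul_eq_coe_smul (K := 𝕜), RCLike.real_smul_eq_coe_smul (K := 𝕜),
        inner_smul_right, inner_smul_right, RCLike.re_ofReal_mul, RCLike.re_ofReal_mul,
        mul_comm t, mul_le_mul_iff_right₀ hnpos, inv_mul_eq_div, le_div_iff₀ hy0'] at hy2'
      exact hy2'
    rw [mem_closedBall, dist_eq_norm]
    refine le_of_sq_le_sq ?_ hrpos.le
    rw [norm_sub_sq (𝕜 := 𝕜), inner_smul_right, RCLike.re_ofReal_mul, norm_smul, hr2,
      ← inner_conj_symm, RCLike.conj_re, RCLike.norm_ofReal, mul_pow, sq_abs]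
    have hu2 : ‖u‖ ^ 2 ≤ 1 := pow_le_one₀ (norm_nonneg _) hu
    have h1 : (t / 2) ^ 2 * ‖u‖ ^ 2 ≤ (t / 2) ^ 2 := by nlinarith [sq_nonneg (t / 2)]
    have h2 : t * (t * ‖y‖) ≤ t * RCLike.re (inner 𝕜 u y) := by gcongr
    have h3 : t ^ 2 * (1 - ‖y‖) ≤ 1 * (1 - ‖y‖) := by gcongr
    nlinarith [norm_nonneg y]
  rw [uniformSphere_apply hn hS]
  calc _ ≤ (Measure.addHaar (ball (0 : EuclideanSpace 𝕜 (Fin n)) 1))⁻¹ *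
        Measure.addHaar (closedBall (((t / 2 : ℝ) : 𝕜) • u) r) := by gcongr
    _ = ENNReal.ofReal (r ^ finrank ℝ (EuclideanSpace 𝕜 (Fin n))) := by
        rw [Measure.addHaar_closedBall _ _ hrpos.le, mul_comm, mul_assoc,
          ENNReal.mul_inv_cancel hV0 hVt, mul_one]
    _ ≤ _ := by
        refine ENNReal.ofReal_le_ofReal ?_
        have hr1 : r ≤ 1 := by nlinarith
        have hre : r ≤ Real.exp (-(3 / 8 * t ^ 2)) := by
          refine le_of_sq_le_sq ?_ (Real.exp_pos _).le
          rw [hr2, ← Real.exp_nat_mul]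
          have := Real.add_one_le_exp (((2 : ℕ) : ℝ) * -(3 / 8 * t ^ 2))
          push_cast at this ⊢
          linarith
        calc r ^ finrank ℝ (EuclideanSpace 𝕜 (Fin n)) ≤ r ^ n :=
              pow_le_pow_of_le_one hrpos.le hr1 le_finrank_real
          _ ≤ (Real.exp (-(3 / 8 * t ^ 2))) ^ n := by gcongr
          _ = _ := by
              rw [← Real.exp_nat_mul]
              ring_nf

end Sphere

/-! ### Quadratic statistics and subgaussian marginals. -/

section Moments

open Metric Module

variable {𝕜 : Type} [RCLike 𝕜] {n : ℕ}

/-- The squared modulus `|⟨u, z⟩|²`. -/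
def sqInner (u z : EuclideanSpace 𝕜 (Fin n)) : ℝ := ‖inner 𝕜 u z‖ ^ 2

/-- The real part of the conjugate of `⟨e, z⟩` times `⟨v, z⟩`. -/
def crossRe (e v z : EuclideanSpace 𝕜 (Fin n)) : ℝ :=
  RCLike.re (starRingEnd 𝕜 (inner 𝕜 e z) * inner 𝕜 v z)

theorem sqInner_nonneg (u z : EuclideanSpace 𝕜 (Fin n)) : 0 ≤ sqInner u z := sq_nonneg _

@[fun_prop]
theorem continuous_sqInner (u : EuclideanSpace 𝕜 (Fin n)) : Continuous (sqInner u) := by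
  unfold sqInner
  fun_prop

@[fun_prop]
theorem continuous_crossRe (e v : EuclideanSpace 𝕜 (Fin n)) : Continuous (crossRe e v) := by
  unfold crossRe
  exact RCLike.continuous_re.comp ((RCLike.continuous_conj.comp
    (continuous_const.inner continuous_id)).mul (continuous_const.inner continuous_id))

@[fun_prop]
theorem measurable_sqInner (u : EuclideanSpace 𝕜 (Fin n)) : Measurable (sqInner u) :=
  (continuous_sqInner u).measurable

theorem sqInner_le (u z : EuclideanSpace 𝕜 (Fin n)) : sqInner u z ≤ ‖u‖ ^ 2 * ‖z‖ ^ 2 := by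
  rw [sqInner, ← mul_pow]
  gcongr
  exact norm_inner_le_norm u z

theorem sqInner_smul (c : 𝕜) (u z : EuclideanSpace 𝕜 (Fin n)) :
    sqInner (c • u) z = ‖c‖ ^ 2 * sqInner u z := by
  rw [sqInner, sqInner, inner_smul_left, norm_mul, RCLike.norm_conj, mul_pow]

theorem crossRe_sub_right (e v w z : EuclideanSpace 𝕜 (Fin n)) :
    crossRe e (v - w) z = crossRe e v z - crossRe e w z := by
  simp [crossRe, inner_sub_left, mul_sub]

theorem crossRe_neg_right (e v z : EuclideanSpace 𝕜 (Fin n)) :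
    crossRe e (-v) z = -crossRe e v z := by
  simp [crossRe]

theorem crossRe_real_smul_right (r : ℝ) (e v z : EuclideanSpace 𝕜 (Fin n)) :
    crossRe e ((r : 𝕜) • v) z = r * crossRe e v z := by
  simp only [crossRe, inner_smul_left, RCLike.conj_ofReal]
  rw [mul_left_comm, RCLike.re_ofReal_mul]

/-- Polarization. -/
theorem sqInner_add (e v z : EuclideanSpace 𝕜 (Fin n)) :
    sqInner (e + v) z = sqInner e z + 2 * crossRe e v z + sqInner v z := by
  have h := norm_add_sq (𝕜 := 𝕜) (inner 𝕜 e z : 𝕜) (inner 𝕜 v z)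
  rw [sqInner, inner_add_left, h, RCLike.inner_apply, mul_comm (inner 𝕜 v z : 𝕜)]
  rfl

theorem sqInner_sub (e v z : EuclideanSpace 𝕜 (Fin n)) :
    sqInner (e - v) z = sqInner e z - 2 * crossRe e v z + sqInner v z := by
  rw [sub_eq_add_neg, sqInner_add, crossRe_neg_right]
  simp [sqInner]
  ring

theorem abs_crossRe_le (e v z : EuclideanSpace 𝕜 (Fin n)) :
    |crossRe e v z| ≤ ‖(inner 𝕜 e z : 𝕜)‖ * ‖(inner 𝕜 v z : 𝕜)‖ := by
  refine (RCLike.abs_re_le_norm _).trans ?_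
  rw [norm_mul, RCLike.norm_conj]

theorem two_mul_abs_crossRe_le (e v z : EuclideanSpace 𝕜 (Fin n)) :
    2 * |crossRe e v z| ≤ sqInner e z + sqInner v z := by
  have := abs_crossRe_le e v z
  have h2 := two_mul_le_add_sq ‖(inner 𝕜 e z : 𝕜)‖ ‖(inner 𝕜 v z : 𝕜)‖
  rw [sqInner, sqInner]
  linarith

theorem sq_norm_eq_re_sq_add_im_sq (a : 𝕜) :
    ‖a‖ ^ 2 = RCLike.re a ^ 2 + RCLike.im a ^ 2 := by
  rw [RCLike.norm_sq_eq_def, sq, sq]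

/-- This is |w|² = (Re w)² + (Im w)² for w the product in `crossRe`, the imaginary part being the
cross term with `I • v`. Over ℝ one has `RCLike.I = 0`, so the second square vanishes and both
fields are treated at once. -/
theorem sqInner_mul_sqInner (e v z : EuclideanSpace 𝕜 (Fin n)) :
    sqInner e z * sqInner v z = crossRe e v z ^ 2 + crossRe e ((RCLike.I : 𝕜) • v) z ^ 2 := by
  have h : crossRe e ((RCLike.I : 𝕜) • v) z =
      RCLike.im (starRingEnd 𝕜 (inner 𝕜 e z) * inner 𝕜 v z) := by
    rw [crossRe, inner_smul_left, RCLike.conj_I, neg_mul, mul_neg, mul_left_comm, map_neg,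
      RCLike.I_mul_re, neg_neg]
  rw [h, crossRe, ← sq_norm_eq_re_sq_add_im_sq]
  rw [sqInner, sqInner, norm_mul, RCLike.norm_conj, mul_pow]

theorem integrable_of_continuous (hn : 1 ≤ n) {G : EuclideanSpace 𝕜 (Fin n) → ℝ}
    (hG : Continuous G) : Integrable G (uniformSphere 𝕜 n) := by
  have := isProbabilityMeasure_uniformSphere (𝕜 := 𝕜) hn
  obtain ⟨C, hC⟩ := (isCompact_closedBall (0 : EuclideanSpace 𝕜 (Fin n))
    (Real.sqrt n)).exists_bound_of_continuousOn hG.continuousOn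
  refine Integrable.of_bound hG.aestronglyMeasurable C ?_
  filter_upwards [ae_norm_eq_sqrt (𝕜 := 𝕜) (n := n)] with z hz
  exact hC z (by simp [hz])

/-- If the squared modulus is at least y, then the real or the imaginary part has square at least y
/ 2, so z lies in one of four caps, around ±u and ±I u, of relative height t with t² = y / (2n). For
y > n the event is null. Over ℝ the last two caps are centred at 0, which the cap bound allows since
it needs only norm at most 1. -/
theorem uniformSphere_sqInner_ge_le (hn : 1 ≤ n) {u : EuclideanSpace 𝕜 (Fin n)} (hu : ‖u‖ ≤ 1)
    {y : ℝ} (hy : 0 ≤ y) :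
    (uniformSphere 𝕜 n).real {z | y ≤ sqInner u z} ≤ 4 * Real.exp (-(3 / 16 * y)) := by
  have := isProbabilityMeasure_uniformSphere (𝕜 := 𝕜) hn
  have hn' : (0 : ℝ) < n := by exact_mod_cast hn
  rcases lt_or_ge (n : ℝ) y with h | h
  · have : (uniformSphere 𝕜 n) {z | y ≤ sqInner u z} = 0 := by
      rw [measure_eq_zero_iff_ae_notMem]
      filter_upwards [ae_norm_eq_sqrt (𝕜 := 𝕜) (n := n)] with z hz hmem
      have h1 := sqInner_le u z
      rw [hz, Real.sq_sqrt hn'.le] at h1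
      have h2 : ‖u‖ ^ 2 ≤ 1 := pow_le_one₀ (norm_nonneg _) hu
      have h3 : y ≤ sqInner u z := hmem
      nlinarith
    rw [measureReal_def, this]
    simp only [ENNReal.toReal_zero]
    positivity
  · set t : ℝ := Real.sqrt (y / (2 * n)) with ht
    have ht2 : t ^ 2 = y / (2 * n) := Real.sq_sqrt (by positivity)
    have ht0 : 0 ≤ t := Real.sqrt_nonneg _
    have ht1 : t ≤ 1 := by
      refine Real.sqrt_le_one.2 ((div_le_one (by positivity)).2 ?_)
      linarith
    have htn : (t * Real.sqrt n) ^ 2 = y / 2 := by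
      rw [mul_pow, ht2, Real.sq_sqrt hn'.le]
      field_simp
    have hcap : ∀ v : EuclideanSpace 𝕜 (Fin n), ‖v‖ ≤ 1 → (uniformSphere 𝕜 n).real
        {z | t * Real.sqrt n ≤ RCLike.re (inner 𝕜 v z)} ≤ Real.exp (-(3 / 16 * y)) := by
      intro v hv
      have h1 := ENNReal.toReal_mono (by simp) (uniformSphere_cap_le hn hv ht0 ht1)
      rw [ENNReal.toReal_ofReal (Real.exp_pos _).le] at h1
      refine h1.trans_eq ?_
      congr 2
      rw [ht2]
      field_simp
      ring
    have hI : ‖(RCLike.I : 𝕜) • u‖ ≤ 1 := by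
      rw [norm_smul]
      rcases eq_or_ne (RCLike.I : 𝕜) 0 with h0 | h0
      · simp [h0]
      · simpa [RCLike.norm_I_of_ne_zero h0] using hu
    have hsub : {z | y ≤ sqInner u z} ⊆
        ({z | t * Real.sqrt n ≤ RCLike.re (inner 𝕜 u z)} ∪
          {z | t * Real.sqrt n ≤ RCLike.re (inner 𝕜 (-u) z)}) ∪
        ({z | t * Real.sqrt n ≤ RCLike.re (inner 𝕜 ((RCLike.I : 𝕜) • u) z)} ∪
          {z | t * Real.sqrt n ≤ RCLike.re (inner 𝕜 (-((RCLike.I : 𝕜) • u)) z)}) := by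
      intro z hz
      have hz' : y ≤ sqInner u z := hz
      rw [sqInner, sq_norm_eq_re_sq_add_im_sq] at hz'
      have him : RCLike.re (inner 𝕜 ((RCLike.I : 𝕜) • u) z) = RCLike.im (inner 𝕜 u z) := by
        rw [inner_smul_left, RCLike.conj_I, neg_mul, map_neg, RCLike.I_mul_re, neg_neg]
      simp only [Set.mem_union, Set.mem_ofPred_eq, inner_neg_left, map_neg, him]
      have hb : 0 ≤ t * Real.sqrt n := by positivity
      by_contra! hcon
      obtain ⟨⟨h1, h2⟩, h3, h4⟩ := hcon
      have e1 : RCLike.re (inner 𝕜 u z) ^ 2 < y / 2 := by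
        rw [← htn]; exact sq_lt_sq' (by linarith) h1
      have e2 : RCLike.im (inner 𝕜 u z) ^ 2 < y / 2 := by
        rw [← htn]; exact sq_lt_sq' (by linarith) h3
      linarith
    refine (measureReal_mono hsub).trans ((measureReal_union_le _ _).trans ?_)
    have h1 := measureReal_union_le (μ := uniformSphere 𝕜 n)
      {z | t * Real.sqrt n ≤ RCLike.re (inner 𝕜 u z)}
      {z | t * Real.sqrt n ≤ RCLike.re (inner 𝕜 (-u) z)}
    have h2 := measureReal_union_le (μ := uniformSphere 𝕜 n)
      {z | t * Real.sqrt n ≤ RCLike.re (inner 𝕜 ((RCLike.I : 𝕜) • u) z)}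
      {z | t * Real.sqrt n ≤ RCLike.re (inner 𝕜 (-((RCLike.I : 𝕜) • u)) z)}
    linarith [hcap u hu, hcap (-u) (by simpa using hu), hcap _ hI,
      hcap (-((RCLike.I : 𝕜) • u)) (by simpa using hI)]

/-- One-dimensional marginals of the sphere of radius `√n` are subgaussian. -/
theorem integral_exp_sqInner_le (hn : 1 ≤ n) {u : EuclideanSpace 𝕜 (Fin n)} (hu : ‖u‖ ≤ 1) :
    ∫ z, Real.exp (1 / 16 * sqInner u z) ∂(uniformSphere 𝕜 n) ≤ 40 := by
  have := isProbabilityMeasure_uniformSphere (𝕜 := 𝕜) hn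
  have hmeas : ∀ k : ℕ, MeasurableSet {z | (k : ℝ) ≤ sqInner u z} := fun k =>
    measurableSet_le measurable_const (measurable_sqInner u)
  have hint : ∀ k ∈ Finset.range (n + 1), Integrable
      ({z | (k : ℝ) ≤ sqInner u z}.indicator fun _ => Real.exp (((k : ℝ) + 1) / 16))
      (uniformSphere 𝕜 n) := fun k _ => (integrable_const _).indicator (hmeas k)
  -- Slicing by the integer part k of `sqInner u z`, which is at most n: the tail exp(-3k/16)
  -- against the value exp((k+1)/16) leaves a geometric series of ratio exp(-1/8).
  have hle : ∀ᵐ z ∂(uniformSphere 𝕜 n), Real.exp (1 / 16 * sqInner u z) ≤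
      ∑ k ∈ Finset.range (n + 1),
        {z | (k : ℝ) ≤ sqInner u z}.indicator (fun _ => Real.exp (((k : ℝ) + 1) / 16)) z := by
    filter_upwards [ae_norm_eq_sqrt (𝕜 := 𝕜) (n := n)] with z hz
    have h1 := sqInner_le u z
    rw [hz, Real.sq_sqrt (Nat.cast_nonneg _)] at h1
    have h2 : ‖u‖ ^ 2 ≤ 1 := pow_le_one₀ (norm_nonneg _) hu
    have h3 : sqInner u z ≤ n := h1.trans (mul_le_of_le_one_left (Nat.cast_nonneg _) h2)
    set k := ⌊sqInner u z⌋₊ with hk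
    have hkn : k ∈ Finset.range (n + 1) := by
      rw [Finset.mem_range, Nat.lt_succ_iff]
      exact Nat.floor_le_of_le h3
    have hkle : (k : ℝ) ≤ sqInner u z := Nat.floor_le (sqInner_nonneg u z)
    have hklt : sqInner u z < k + 1 := Nat.lt_floor_add_one _
    refine le_trans ?_ (Finset.single_le_sum (f := fun k : ℕ =>
      {z | (k : ℝ) ≤ sqInner u z}.indicator (fun _ => Real.exp (((k : ℝ) + 1) / 16)) z)
      (fun j _ => Set.indicator_nonneg (fun _ _ => (Real.exp_pos _).le) z) hkn)
    simp only [Set.indicator, Set.mem_ofPred_eq, hkle, if_true]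
    refine Real.exp_le_exp.2 (by linarith)
  calc _ ≤ ∫ z, ∑ k ∈ Finset.range (n + 1),
        {z | (k : ℝ) ≤ sqInner u z}.indicator (fun _ => Real.exp (((k : ℝ) + 1) / 16)) z
          ∂(uniformSphere 𝕜 n) :=
        integral_mono_ae (integrable_of_continuous hn (by fun_prop))
          (integrable_finsetSum _ hint) hle
    _ = ∑ k ∈ Finset.range (n + 1),
          (uniformSphere 𝕜 n).real {z | (k : ℝ) ≤ sqInner u z} * Real.exp (((k : ℝ) + 1) / 16) := by
        rw [integral_finsetSum _ hint]
        refine Finset.sum_congr rfl fun k _ => ?_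
        rw [integral_indicator_const _ (hmeas k), smul_eq_mul]
    _ ≤ ∑ k ∈ Finset.range (n + 1), 4 * Real.exp (1 / 16) * Real.exp (-(1 / 8)) ^ k := by
        refine Finset.sum_le_sum fun k _ => ?_
        refine (mul_le_mul_of_nonneg_right
          (uniformSphere_sqInner_ge_le hn hu (Nat.cast_nonneg k)) (Real.exp_pos _).le).trans_eq ?_
        rw [← Real.exp_nat_mul, mul_assoc, mul_assoc, ← Real.exp_add, ← Real.exp_add]
        ring_nf
    _ ≤ 4 * Real.exp (1 / 16) * (1 - Real.exp (-(1 / 8)))⁻¹ := by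
        rw [← Finset.mul_sum]
        gcongr
        have h1 : Real.exp (-(1 / 8)) < 1 := Real.exp_lt_one_iff.2 (by norm_num)
        rw [← tsum_geometric_of_lt_one (Real.exp_pos _).le h1]
        exact (summable_geometric_of_lt_one (Real.exp_pos _).le h1).sum_le_tsum _
          fun k _ => by positivity
    _ ≤ 4 * (16 / 15) * 9 := by
        have h1 : Real.exp (1 / 16) ≤ 16 / 15 := by
          have h := Real.add_one_le_exp (-(1 / 16) : ℝ)
          rw [Real.exp_neg] at h
          rw [← inv_inv (Real.exp (1 / 16)), inv_le_comm₀ (by positivity) (by norm_num)]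
          linarith
        have h2 : (1 - Real.exp (-(1 / 8)))⁻¹ ≤ 9 := by
          have h := Real.add_one_le_exp (1 / 8 : ℝ)
          have h3 : Real.exp (-(1 / 8)) ≤ 8 / 9 := by
            rw [Real.exp_neg, inv_le_comm₀ (by positivity) (by norm_num)]
            linarith
          rw [inv_le_comm₀ (by linarith) (by norm_num)]
          linarith
        have h4 : Real.exp (-(1 / 8)) < 1 := Real.exp_lt_one_iff.2 (by norm_num)
        gcongr
    _ ≤ 40 := by norm_num

end Moments

/-! ### Unitary invariance and second-order moments. -/

section Invariance

open Metric Module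

variable {𝕜 : Type} [RCLike 𝕜] {n : ℕ}

theorem exists_orthonormalBasis_of_unit {u : EuclideanSpace 𝕜 (Fin n)} (hu : ‖u‖ = 1)
    (i₀ : Fin n) :
    ∃ b : OrthonormalBasis (Fin n) 𝕜 (EuclideanSpace 𝕜 (Fin n)), b i₀ = u := by
  obtain ⟨b, hb⟩ := Orthonormal.exists_orthonormalBasis_extension_of_card_eq (𝕜 := 𝕜)
    (E := EuclideanSpace 𝕜 (Fin n)) (ι := Fin n) (by simp) (v := fun _ => u) (s := {i₀})
    ⟨fun i => by simpa using hu, fun i j hij => absurd (Subsingleton.elim i j) hij⟩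
  exact ⟨b, hb i₀ rfl⟩

theorem exists_orthonormalBasis_of_pair {u v : EuclideanSpace 𝕜 (Fin n)} (hu : ‖u‖ = 1)
    (hv : ‖v‖ = 1) (huv : inner 𝕜 u v = 0) {i j : Fin n} (hij : i ≠ j) :
    ∃ b : OrthonormalBasis (Fin n) 𝕜 (EuclideanSpace 𝕜 (Fin n)), b i = u ∧ b j = v := by
  classical
  have hvu : inner 𝕜 v u = 0 := inner_eq_zero_symm.1 huv
  have horth : Orthonormal 𝕜
      (({i, j} : Set (Fin n)).domRestrict fun k => if k = i then u else v) := by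
    refine ⟨?_, ?_⟩
    · rintro ⟨k, hk⟩
      change ‖if k = i then u else v‖ = 1
      split_ifs <;> assumption
    · rintro ⟨k, hk⟩ ⟨l, hl⟩ hkl
      change inner 𝕜 (if k = i then u else v) (if l = i then u else v) = 0
      have hkl' : k ≠ l := fun h => hkl (Subtype.ext h)
      rcases hk with rfl | rfl <;> rcases hl with rfl | rfl
      · exact absurd rfl hkl'
      · rw [if_pos rfl, if_neg hij.symm]; exact huv
      · rw [if_pos rfl, if_neg hij.symm]; exact hvu
      · exact absurd rfl hkl'
  obtain ⟨b, hb⟩ := horth.exists_orthonormalBasis_extension_of_card_eq (by simp)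
  refine ⟨b, ?_, ?_⟩
  · rw [hb i (by simp), if_pos rfl]
  · rw [hb j (by simp), if_neg hij.symm]

theorem one_lt_of_orthonormal_pair {u v : EuclideanSpace 𝕜 (Fin n)} (hu : ‖u‖ = 1)
    (hv : ‖v‖ = 1) (huv : inner 𝕜 u v = 0) : 1 < n := by
  rcases Nat.lt_or_ge 1 n with h | h
  · exact h
  exfalso
  rcases Nat.le_one_iff_eq_zero_or_eq_one.1 h with rfl | rfl
  · rw [Subsingleton.elim u 0, norm_zero] at hu
    exact one_ne_zero hu.symm
  · obtain ⟨b, hb⟩ := exists_orthonormalBasis_of_unit hu 0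
    have hsum := b.sum_repr v
    rw [Fin.sum_univ_one, b.repr_apply_apply, hb, huv, zero_smul] at hsum
    rw [← hsum, norm_zero] at hv
    exact one_ne_zero hv.symm

theorem integral_comp_linearIsometryEquiv (hn : 1 ≤ n)
    (U : EuclideanSpace 𝕜 (Fin n) ≃ₗᵢ[𝕜] EuclideanSpace 𝕜 (Fin n))
    (G : EuclideanSpace 𝕜 (Fin n) → ℝ) :
    ∫ z, G (U z) ∂(uniformSphere 𝕜 n) = ∫ z, G z ∂(uniformSphere 𝕜 n) :=
  (measurePreserving_uniformSphere hn U).integral_comp U.toHomeomorph.measurableEmbedding G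

/-- All unit vectors have the same marginal distribution. -/
theorem integral_inner_eq (hn : 1 ≤ n) {u u' : EuclideanSpace 𝕜 (Fin n)} (hu : ‖u‖ = 1)
    (hu' : ‖u'‖ = 1) (F : 𝕜 → ℝ) :
    ∫ z, F (inner 𝕜 u z) ∂(uniformSphere 𝕜 n) = ∫ z, F (inner 𝕜 u' z) ∂(uniformSphere 𝕜 n) := by
  obtain ⟨b, hb⟩ := exists_orthonormalBasis_of_unit hu ⟨0, hn⟩
  obtain ⟨b', hb'⟩ := exists_orthonormalBasis_of_unit hu' ⟨0, hn⟩
  set U := b.equiv b' (Equiv.refl _) with hU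
  have h1 : U u = u' := by rw [← hb, ← hb', hU, OrthonormalBasis.equiv_apply_basis]; rfl
  rw [← integral_comp_linearIsometryEquiv hn U fun z => F (inner 𝕜 u' z)]
  simp_rw [← h1, LinearIsometryEquiv.inner_map_map]

/-- All orthonormal pairs have the same joint marginal distribution. -/
theorem integral_inner_pair_eq {u v u' v' : EuclideanSpace 𝕜 (Fin n)}
    (hu : ‖u‖ = 1) (hv : ‖v‖ = 1) (huv : inner 𝕜 u v = 0)
    (hu' : ‖u'‖ = 1) (hv' : ‖v'‖ = 1) (huv' : inner 𝕜 u' v' = 0) (F : 𝕜 → 𝕜 → ℝ) :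
    ∫ z, F (inner 𝕜 u z) (inner 𝕜 v z) ∂(uniformSphere 𝕜 n) =
      ∫ z, F (inner 𝕜 u' z) (inner 𝕜 v' z) ∂(uniformSphere 𝕜 n) := by
  have hn := one_lt_of_orthonormal_pair hu hv huv
  have hij : (⟨0, by omega⟩ : Fin n) ≠ ⟨1, hn⟩ := by simp
  obtain ⟨b, hb, hc⟩ := exists_orthonormalBasis_of_pair hu hv huv hij
  obtain ⟨b', hb', hc'⟩ := exists_orthonormalBasis_of_pair hu' hv' huv' hij
  set U := b.equiv b' (Equiv.refl _) with hU
  have h1 : U u = u' := by rw [← hb, ← hb', hU, OrthonormalBasis.equiv_apply_basis]; rfl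
  have h2 : U v = v' := by rw [← hc, ← hc', hU, OrthonormalBasis.equiv_apply_basis]; rfl
  rw [← integral_comp_linearIsometryEquiv hn.le U fun z => F (inner 𝕜 u' z) (inner 𝕜 v' z)]
  simp_rw [← h1, ← h2, LinearIsometryEquiv.inner_map_map]

theorem sum_sqInner_basis (b : OrthonormalBasis (Fin n) 𝕜 (EuclideanSpace 𝕜 (Fin n)))
    (z : EuclideanSpace 𝕜 (Fin n)) : ∑ j, sqInner (b j) z = ‖z‖ ^ 2 :=
  b.sum_sq_norm_inner_right z

/-- The squared coefficients along an orthonormal basis have equal integrals, and their sum is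
almost surely n. -/
theorem integral_sqInner (hn : 1 ≤ n) {u : EuclideanSpace 𝕜 (Fin n)} (hu : ‖u‖ = 1) :
    ∫ z, sqInner u z ∂(uniformSphere 𝕜 n) = 1 := by
  have := isProbabilityMeasure_uniformSphere (𝕜 := 𝕜) hn
  obtain ⟨b, hb⟩ := exists_orthonormalBasis_of_unit hu ⟨0, hn⟩
  have h1 : ∫ z, ∑ j, sqInner (b j) z ∂(uniformSphere 𝕜 n) = n := by
    have : ∀ᵐ z ∂(uniformSphere 𝕜 n), ∑ j, sqInner (b j) z = n := by
      filter_upwards [ae_norm_eq_sqrt (𝕜 := 𝕜) (n := n)] with z hz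
      rw [sum_sqInner_basis, hz, Real.sq_sqrt (Nat.cast_nonneg _)]
    rw [integral_congr_ae this]
    simp
  rw [integral_finsetSum _ fun j _ => integrable_of_continuous hn (continuous_sqInner _)] at h1
  have h2 : ∀ j, ∫ z, sqInner (b j) z ∂(uniformSphere 𝕜 n) =
      ∫ z, sqInner u z ∂(uniformSphere 𝕜 n) := fun j =>
    integral_inner_eq hn (b.norm_eq_one j) hu fun a => ‖a‖ ^ 2
  rw [Finset.sum_congr rfl fun j _ => h2 j] at h1
  simp only [Finset.sum_const, Finset.card_univ, Fintype.card_fin, nsmul_eq_mul] at h1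
  exact mul_left_cancel₀ (Nat.cast_ne_zero.2 (by omega : n ≠ 0)) (h1.trans (mul_one _).symm)

variable {e v : EuclideanSpace 𝕜 (Fin n)}

/-- For an orthonormal pair `e, v`, the cross term is half the difference of the squared
coefficients along the orthonormal pair `(e ± v) / √2`. -/
theorem exists_rotated_pair (he : ‖e‖ = 1) (hv : ‖v‖ = 1) (hev : inner 𝕜 e v = 0) :
    ∃ p q : EuclideanSpace 𝕜 (Fin n), ‖p‖ = 1 ∧ ‖q‖ = 1 ∧ inner 𝕜 p q = 0 ∧
      ∀ z, 2 * crossRe e v z = sqInner p z - sqInner q z := by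
  have hve : inner 𝕜 v e = 0 := inner_eq_zero_symm.1 hev
  set r : ℝ := (Real.sqrt 2)⁻¹ with hr
  have hr0 : 0 ≤ r := by positivity
  have hr2 : r ^ 2 = 1 / 2 := by
    rw [hr, inv_pow, Real.sq_sqrt (by norm_num)]
    norm_num
  have hnorm : ∀ w : EuclideanSpace 𝕜 (Fin n), ‖w‖ ^ 2 = 2 → ‖((r : ℝ) : 𝕜) • w‖ = 1 := by
    intro w hw
    rw [norm_smul, RCLike.norm_ofReal, abs_of_nonneg hr0]
    refine (sq_eq_sq₀ (by positivity) (by norm_num)).1 ?_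
    rw [mul_pow, hr2, hw]
    norm_num
  refine ⟨((r : ℝ) : 𝕜) • (e + v), ((r : ℝ) : 𝕜) • (e - v), hnorm _ ?_, hnorm _ ?_, ?_, ?_⟩
  · rw [norm_add_sq (𝕜 := 𝕜), he, hv, hev]
    norm_num
  · rw [norm_sub_sq (𝕜 := 𝕜), he, hv, hev]
    norm_num
  · rw [inner_smul_left, inner_smul_right, inner_add_left, inner_sub_right, inner_sub_right, hev,
      hve, inner_self_eq_norm_sq_to_K, inner_self_eq_norm_sq_to_K, he, hv]
    simp
  · intro z
    rw [sqInner_smul, sqInner_smul, RCLike.norm_ofReal, sq_abs, hr2, sqInner_add, sqInner_sub]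
    ring

/-- The squared coefficients along an orthonormal pair differ substantially on average. -/
theorem one_le_integral_sq_sub (he : ‖e‖ = 1) (hv : ‖v‖ = 1) (hev : inner 𝕜 e v = 0) :
    1 ≤ ∫ z, (sqInner e z - sqInner v z) ^ 2 ∂(uniformSphere 𝕜 n) := by
  have hn := one_lt_of_orthonormal_pair he hv hev
  have := isProbabilityMeasure_uniformSphere (𝕜 := 𝕜) hn.le
  have hI : ∀ {G : EuclideanSpace 𝕜 (Fin n) → ℝ}, Continuous G →
      Integrable G (uniformSphere 𝕜 n) := fun h => integrable_of_continuous hn.le h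
  -- Let A_j be the squared coefficients along an orthonormal basis. Rotating a pair by 45 degrees
  -- shows that a squared cross term has mean c / 4, so E[A_j A_k] ≤ c / 2 for j ≠ k. Expanding c =
  -- 2 E[A_j²] - 2 E[A_j A_k] then gives E[A_j²] ≤ c. Since the sum of all E[A_j A_k] is n², it
  -- follows that n² ≤ (n² + n) c / 2, and n > 1 forces c ≥ 1.
  set c := ∫ z, (sqInner e z - sqInner v z) ^ 2 ∂(uniformSphere 𝕜 n) with hc
  have hc0 : 0 ≤ c := integral_nonneg fun z => sq_nonneg _
  have hcross : ∀ w : EuclideanSpace 𝕜 (Fin n), ‖w‖ = 1 → inner 𝕜 e w = 0 →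
      ∫ z, crossRe e w z ^ 2 ∂(uniformSphere 𝕜 n) = c / 4 := by
    intro w hw hew
    obtain ⟨p, q, hp, hq, hpq, h⟩ := exists_rotated_pair he hw hew
    have h2 : ∀ z, crossRe e w z ^ 2 = 1 / 4 * (sqInner p z - sqInner q z) ^ 2 := by
      intro z
      rw [← h z]
      ring
    simp_rw [h2]
    rw [integral_const_mul, hc]
    have := integral_inner_pair_eq hp hq hpq he hv hev fun a b => (‖a‖ ^ 2 - ‖b‖ ^ 2) ^ 2
    simp only [sqInner]
    rw [this]
    ring
  have hb : ∫ z, sqInner e z * sqInner v z ∂(uniformSphere 𝕜 n) ≤ c / 2 := by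
    simp_rw [sqInner_mul_sqInner]
    rw [integral_add (hI (by fun_prop)) (hI (by fun_prop)), hcross v hv hev]
    rcases eq_or_ne (RCLike.I : 𝕜) 0 with h0 | h0
    · simp only [h0, zero_smul, crossRe, inner_zero_left, mul_zero, map_zero]
      simp
      linarith
    · rw [hcross ((RCLike.I : 𝕜) • v) (by rw [norm_smul, RCLike.norm_I_of_ne_zero h0, hv, one_mul])
        (by rw [inner_smul_right, hev, mul_zero])]
      linarith
  have ha : ∫ z, sqInner e z * sqInner e z ∂(uniformSphere 𝕜 n) ≤ c := by
    have h1 : ∫ z, sqInner v z * sqInner v z ∂(uniformSphere 𝕜 n) =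
        ∫ z, sqInner e z * sqInner e z ∂(uniformSphere 𝕜 n) :=
      integral_inner_eq hn.le hv he fun a => ‖a‖ ^ 2 * ‖a‖ ^ 2
    have h2 : c = ∫ z, sqInner e z * sqInner e z ∂(uniformSphere 𝕜 n) -
        2 * ∫ z, sqInner e z * sqInner v z ∂(uniformSphere 𝕜 n) +
        ∫ z, sqInner v z * sqInner v z ∂(uniformSphere 𝕜 n) := by
      rw [← integral_const_mul, ← integral_sub (hI (by fun_prop)) (hI (by fun_prop)),
        ← integral_add (hI (by fun_prop)) (hI (by fun_prop)), hc]
      congr 1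
      ext z
      ring
    linarith
  obtain ⟨b, -⟩ := exists_orthonormalBasis_of_unit he ⟨0, by omega⟩
  have hjk : ∀ j k, ∫ z, sqInner (b j) z * sqInner (b k) z ∂(uniformSphere 𝕜 n) ≤
      c / 2 + if j = k then c / 2 else 0 := by
    intro j k
    split_ifs with h
    · subst h
      have h1 : ∫ z, sqInner (b j) z * sqInner (b j) z ∂(uniformSphere 𝕜 n) =
          ∫ z, sqInner e z * sqInner e z ∂(uniformSphere 𝕜 n) :=
        integral_inner_eq hn.le (b.norm_eq_one j) he fun a => ‖a‖ ^ 2 * ‖a‖ ^ 2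
      linarith
    · have h1 : ∫ z, sqInner (b j) z * sqInner (b k) z ∂(uniformSphere 𝕜 n) =
          ∫ z, sqInner e z * sqInner v z ∂(uniformSphere 𝕜 n) :=
        integral_inner_pair_eq (b.norm_eq_one j) (b.norm_eq_one k) (b.inner_eq_zero h) he hv hev
          fun a b => ‖a‖ ^ 2 * ‖b‖ ^ 2
      linarith
  have hsum : ∑ j, ∑ k, ∫ z, sqInner (b j) z * sqInner (b k) z ∂(uniformSphere 𝕜 n) =
      (n : ℝ) ^ 2 := by
    have h1 : ∀ᵐ z ∂(uniformSphere 𝕜 n),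
        ∑ j, ∑ k, sqInner (b j) z * sqInner (b k) z = (n : ℝ) ^ 2 := by
      filter_upwards [ae_norm_eq_sqrt (𝕜 := 𝕜) (n := n)] with z hz
      rw [← Finset.sum_mul_sum, sum_sqInner_basis, hz, Real.sq_sqrt (Nat.cast_nonneg _), sq]
    have h2 := integral_congr_ae h1
    rw [integral_finsetSum _ fun j _ => hI (by fun_prop)] at h2
    rw [Finset.sum_congr rfl fun j _ =>
      (integral_finsetSum (μ := uniformSphere 𝕜 n) Finset.univ
        (f := fun k z => sqInner (b j) z * sqInner (b k) z) fun k _ => hI (by fun_prop))] at h2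
    rw [h2]
    simp
  have hle := Finset.sum_le_sum fun j (_ : j ∈ Finset.univ) =>
    Finset.sum_le_sum fun k (_ : k ∈ Finset.univ) => hjk j k
  rw [hsum] at hle
  simp only [Finset.sum_add_distrib, Finset.sum_const, Finset.card_univ, Fintype.card_fin,
    nsmul_eq_mul, Finset.sum_ite_eq, Finset.mem_univ, if_true] at hle
  have hn1 : (1 : ℝ) < n := by exact_mod_cast hn
  by_contra! hlt
  have h1 : (n : ℝ) * (n * (c / 2)) ≤ n * (n * (1 / 2)) := by gcongr
  have h2 : (n : ℝ) * (c / 2) ≤ n * (1 / 2) := by gcongr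
  nlinarith

end Invariance

/-! ### Lower bounds for absolute and weighted moments. -/

section WeightedMoments

variable {𝕜 : Type} [RCLike 𝕜] {n : ℕ}

/-- The bounded increasing weight `w / (1 + w)` of `w = |⟨e, z⟩|²`. -/
def weight (e z : EuclideanSpace 𝕜 (Fin n)) : ℝ := sqInner e z / (1 + sqInner e z)

theorem one_add_sqInner_pos (u z : EuclideanSpace 𝕜 (Fin n)) : 0 < 1 + sqInner u z := by
  linarith [sqInner_nonneg u z]

theorem weight_nonneg (e z : EuclideanSpace 𝕜 (Fin n)) : 0 ≤ weight e z :=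
  div_nonneg (sqInner_nonneg e z) (one_add_sqInner_pos e z).le

theorem weight_le_one (e z : EuclideanSpace 𝕜 (Fin n)) : weight e z ≤ 1 := by
  rw [weight, div_le_one (one_add_sqInner_pos e z)]
  linarith

@[fun_prop]
theorem continuous_weight (e : EuclideanSpace 𝕜 (Fin n)) : Continuous (weight e) :=
  (continuous_sqInner e).div (continuous_const.add (continuous_sqInner e))
    fun z => (one_add_sqInner_pos e z).ne'

theorem abs_weight_mul_le (e z : EuclideanSpace 𝕜 (Fin n)) (a : ℝ) : |weight e z * a| ≤ |a| := by
  rw [abs_mul, abs_of_nonneg (weight_nonneg e z)]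
  exact mul_le_of_le_one_left (abs_nonneg a) (weight_le_one e z)

theorem pow_four_le_mul_exp {y : ℝ} (hy : 0 ≤ y) :
    y ^ 4 ≤ 24 * 16 ^ 4 * Real.exp (1 / 16 * y) := by
  have h := Real.pow_div_factorial_le_exp (1 / 16 * y) (by positivity) 4
  have h2 : ((Nat.factorial 4 : ℕ) : ℝ) = 24 := by norm_num [Nat.factorial]
  rw [h2, div_le_iff₀ (by norm_num)] at h
  calc y ^ 4 = 16 ^ 4 * (1 / 16 * y) ^ 4 := by ring
    _ ≤ 16 ^ 4 * (Real.exp (1 / 16 * y) * 24) := by gcongr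
    _ = _ := by ring

theorem integral_sqInner_pow_four_le (hn : 1 ≤ n) {u : EuclideanSpace 𝕜 (Fin n)} (hu : ‖u‖ ≤ 1) :
    ∫ z, sqInner u z ^ 4 ∂(uniformSphere 𝕜 n) ≤ 62914560 := by
  calc _ ≤ ∫ z, 24 * 16 ^ 4 * Real.exp (1 / 16 * sqInner u z) ∂(uniformSphere 𝕜 n) :=
        integral_mono (integrable_of_continuous hn (by fun_prop))
          (integrable_of_continuous hn (by fun_prop))
          fun z => pow_four_le_mul_exp (sqInner_nonneg u z)
    _ = 24 * 16 ^ 4 * ∫ z, Real.exp (1 / 16 * sqInner u z) ∂(uniformSphere 𝕜 n) :=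
        integral_const_mul _ _
    _ ≤ 24 * 16 ^ 4 * 40 := by
        gcongr
        exact integral_exp_sqInner_le hn hu
    _ = 62914560 := by norm_num

variable {e v : EuclideanSpace 𝕜 (Fin n)}

/-- A second moment bounded below and a fourth moment bounded above keep the first absolute moment
away from zero, by integrating a² - a⁴ ≤ a. The rescaling a = |crossRe| / 2^15 makes the
fourth-moment term, below 2^26 / 2^45, small against 2^-17. -/
theorem le_integral_abs_crossRe (he : ‖e‖ = 1) (hv : ‖v‖ = 1) (hev : inner 𝕜 e v = 0) :
    (1 / 2 ^ 18 : ℝ) ≤ ∫ z, |crossRe e v z| ∂(uniformSphere 𝕜 n) := by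
  have hn := (one_lt_of_orthonormal_pair he hv hev).le
  have hI : ∀ {G : EuclideanSpace 𝕜 (Fin n) → ℝ}, Continuous G →
      Integrable G (uniformSphere 𝕜 n) := fun h => integrable_of_continuous hn h
  have h2 : 1 / 4 ≤ ∫ z, crossRe e v z ^ 2 ∂(uniformSphere 𝕜 n) := by
    obtain ⟨p, q, hp, hq, hpq, h⟩ := exists_rotated_pair he hv hev
    have h2 : ∀ z, crossRe e v z ^ 2 = 1 / 4 * (sqInner p z - sqInner q z) ^ 2 := by
      intro z
      rw [← h z]
      ring
    simp_rw [h2]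
    rw [integral_const_mul]
    linarith [one_le_integral_sq_sub hp hq hpq]
  have h4 : ∫ z, crossRe e v z ^ 4 ∂(uniformSphere 𝕜 n) ≤ 62914560 := by
    calc _ ≤ ∫ z, (1 / 2 * sqInner e z ^ 4 + 1 / 2 * sqInner v z ^ 4) ∂(uniformSphere 𝕜 n) := by
          refine integral_mono (hI (by fun_prop)) (hI (by fun_prop)) fun z => ?_
          have hc := two_mul_abs_crossRe_le e v z
          have ha := sqInner_nonneg e z
          have hb := sqInner_nonneg v z
          have h0 := abs_nonneg (crossRe e v z)
          change crossRe e v z ^ 4 ≤ _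
          rw [← (by decide : Even 4).pow_abs]
          have h1 : |crossRe e v z| ^ 2 ≤ (sqInner e z ^ 2 + sqInner v z ^ 2) / 2 := by
            nlinarith [sq_nonneg (sqInner e z - sqInner v z)]
          have h3 := sq_nonneg (|crossRe e v z|)
          nlinarith [sq_nonneg (sqInner e z ^ 2 - sqInner v z ^ 2)]
      _ = 1 / 2 * ∫ z, sqInner e z ^ 4 ∂(uniformSphere 𝕜 n) +
            1 / 2 * ∫ z, sqInner v z ^ 4 ∂(uniformSphere 𝕜 n) := by
          rw [integral_add (hI (by fun_prop)) (hI (by fun_prop)), integral_const_mul,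
            integral_const_mul]
      _ ≤ _ := by
          linarith [integral_sqInner_pow_four_le hn he.le, integral_sqInner_pow_four_le hn hv.le]
  calc (1 / 2 ^ 18 : ℝ) ≤ 1 / 2 ^ 15 * (1 / 4) - 1 / 2 ^ 45 * 62914560 := by norm_num
    _ ≤ 1 / 2 ^ 15 * ∫ z, crossRe e v z ^ 2 ∂(uniformSphere 𝕜 n) -
          1 / 2 ^ 45 * ∫ z, crossRe e v z ^ 4 ∂(uniformSphere 𝕜 n) := by gcongr
    _ = ∫ z, (1 / 2 ^ 15 * crossRe e v z ^ 2 - 1 / 2 ^ 45 * crossRe e v z ^ 4)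
          ∂(uniformSphere 𝕜 n) := by
        rw [integral_sub (hI (by fun_prop)) (hI (by fun_prop)), integral_const_mul,
          integral_const_mul]
    _ ≤ _ := by
        refine integral_mono (hI (by fun_prop)) (hI (by fun_prop)) fun z => ?_
        have hkey : ∀ a : ℝ, 0 ≤ a → a ^ 2 - a ^ 4 ≤ a := by
          intro a ha
          rcases le_total a 1 with h | h
          · nlinarith [sq_nonneg (a ^ 2)]
          · have : 1 ≤ a ^ 2 := one_le_pow₀ h
            nlinarith
        have h := hkey (|crossRe e v z| / 2 ^ 15) (by positivity)
        rw [div_pow, div_pow, sq_abs, (by decide : Even 4).pow_abs] at h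
        change 1 / 2 ^ 15 * crossRe e v z ^ 2 - 1 / 2 ^ 45 * crossRe e v z ^ 4 ≤ _
        linarith

/-- The pairs (e, v) and (e, -v) have the same joint law, and the integrand is odd in v. -/
theorem integral_weight_mul_crossRe (he : ‖e‖ = 1) (hv : ‖v‖ = 1) (hev : inner 𝕜 e v = 0) :
    ∫ z, weight e z * crossRe e v z ∂(uniformSphere 𝕜 n) = 0 := by
  have h := integral_inner_pair_eq he hv hev he (v' := -v) (by simpa using hv) (by simpa using hev)
    fun a b => ‖a‖ ^ 2 / (1 + ‖a‖ ^ 2) * RCLike.re (starRingEnd 𝕜 a * b)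
  have h2 : ∫ z, weight e z * crossRe e v z ∂(uniformSphere 𝕜 n) =
      ∫ z, weight e z * crossRe e (-v) z ∂(uniformSphere 𝕜 n) := h
  simp_rw [crossRe_neg_right, mul_neg, integral_neg] at h2
  linarith

/-- With A, B the squared coefficients along e and v, exchanging e and v shows that twice the
difference is the mean of (A/(1+A) - B/(1+B)) (A - B) = (A - B)² / ((1+A)(1+B)), which is
nonnegative by monotonicity of the weight and bounded below by moments. -/
theorem le_integral_weight_mul_sub (he : ‖e‖ = 1) (hv : ‖v‖ = 1) (hev : inner 𝕜 e v = 0) :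
    (1 / 2 ^ 31 : ℝ) ≤ ∫ z, weight e z * sqInner e z ∂(uniformSphere 𝕜 n) -
      ∫ z, weight e z * sqInner v z ∂(uniformSphere 𝕜 n) := by
  have hn := (one_lt_of_orthonormal_pair he hv hev).le
  have := isProbabilityMeasure_uniformSphere (𝕜 := 𝕜) hn
  have hI : ∀ {G : EuclideanSpace 𝕜 (Fin n) → ℝ}, Continuous G →
      Integrable G (uniformSphere 𝕜 n) := fun h => integrable_of_continuous hn h
  have s1 : ∫ z, weight v z * sqInner v z ∂(uniformSphere 𝕜 n) =
      ∫ z, weight e z * sqInner e z ∂(uniformSphere 𝕜 n) :=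
    integral_inner_eq hn hv he fun a => ‖a‖ ^ 2 / (1 + ‖a‖ ^ 2) * ‖a‖ ^ 2
  have s2 : ∫ z, weight v z * sqInner e z ∂(uniformSphere 𝕜 n) =
      ∫ z, weight e z * sqInner v z ∂(uniformSphere 𝕜 n) :=
    integral_inner_pair_eq hv he (inner_eq_zero_symm.1 hev) he hv hev
      fun a b => ‖a‖ ^ 2 / (1 + ‖a‖ ^ 2) * ‖b‖ ^ 2
  have h4 : ∫ z, (sqInner e z - sqInner v z) ^ 2 * ((1 + sqInner e z) * (1 + sqInner v z))
      ∂(uniformSphere 𝕜 n) ≤ 2 ^ 30 := by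
    calc _ ≤ ∫ z, (16 + 8 * sqInner e z ^ 4 + 8 * sqInner v z ^ 4) ∂(uniformSphere 𝕜 n) := by
          refine integral_mono (hI (by fun_prop)) (hI (by fun_prop)) fun z => ?_
          have ha := sqInner_nonneg e z
          have hb := sqInner_nonneg v z
          change (sqInner e z - sqInner v z) ^ 2 * ((1 + sqInner e z) * (1 + sqInner v z)) ≤
            16 + 8 * sqInner e z ^ 4 + 8 * sqInner v z ^ 4
          have hpow : ∀ w : ℝ, 0 ≤ w → (1 + w) ^ 4 ≤ 8 * (1 + w ^ 4) := by
            intro w hw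
            nlinarith [sq_nonneg (1 - w), sq_nonneg (1 - w ^ 2), sq_nonneg (w * (1 - w)),
              sq_nonneg ((1 - w) ^ 2), mul_nonneg hw (sq_nonneg (1 - w))]
          have h1 : (sqInner e z - sqInner v z) ^ 2 ≤
              (1 + sqInner e z) ^ 2 + (1 + sqInner v z) ^ 2 := by nlinarith [mul_nonneg ha hb]
          have h2 : (1 + sqInner e z) * (1 + sqInner v z) ≤
              ((1 + sqInner e z) ^ 2 + (1 + sqInner v z) ^ 2) / 2 := by
            nlinarith [sq_nonneg (sqInner e z - sqInner v z)]
          calc _ ≤ ((1 + sqInner e z) ^ 2 + (1 + sqInner v z) ^ 2) *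
                (((1 + sqInner e z) ^ 2 + (1 + sqInner v z) ^ 2) / 2) := by gcongr
            _ ≤ (1 + sqInner e z) ^ 4 + (1 + sqInner v z) ^ 4 := by
                nlinarith [sq_nonneg ((1 + sqInner e z) ^ 2 - (1 + sqInner v z) ^ 2)]
            _ ≤ _ := by linarith [hpow _ ha, hpow _ hb]
      _ = 16 + 8 * ∫ z, sqInner e z ^ 4 ∂(uniformSphere 𝕜 n) +
            8 * ∫ z, sqInner v z ^ 4 ∂(uniformSphere 𝕜 n) := by
          rw [integral_add (hI (by fun_prop)) (hI (by fun_prop)),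
            integral_add (hI (by fun_prop)) (hI (by fun_prop)), integral_const_mul,
            integral_const_mul]
          simp
      _ ≤ _ := by
          linarith [integral_sqInner_pow_four_le hn he.le, integral_sqInner_pow_four_le hn hv.le]
  -- The reciprocal is replaced by a tangent line, 1/y ≥ 2 t - t² y with t = 2^-30. With `h4` and
  -- second moment at least 1 this leaves 2^-29 - 2^-30, and half of it is 2^-31.
  have hpt : ∀ z, 2 / 2 ^ 30 * (sqInner e z - sqInner v z) ^ 2 - 1 / 2 ^ 60 *
      ((sqInner e z - sqInner v z) ^ 2 * ((1 + sqInner e z) * (1 + sqInner v z))) ≤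
      (weight e z * sqInner e z - weight e z * sqInner v z) +
        (weight v z * sqInner v z - weight v z * sqInner e z) := by
    intro z
    have ha := one_add_sqInner_pos e z
    have hb := one_add_sqInner_pos v z
    have hy : 0 < (1 + sqInner e z) * (1 + sqInner v z) := mul_pos ha hb
    have e1 : (weight e z * sqInner e z - weight e z * sqInner v z) +
        (weight v z * sqInner v z - weight v z * sqInner e z) =
        (sqInner e z - sqInner v z) ^ 2 * ((1 + sqInner e z) * (1 + sqInner v z))⁻¹ := by
      rw [weight, weight]
      field_simp
      ring
    have e2 : 2 / 2 ^ 30 - 1 / 2 ^ 60 * ((1 + sqInner e z) * (1 + sqInner v z)) ≤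
        ((1 + sqInner e z) * (1 + sqInner v z))⁻¹ := by
      rw [← one_div, le_div_iff₀ hy]
      nlinarith [sq_nonneg ((1 + sqInner e z) * (1 + sqInner v z) / 2 ^ 30 - 1)]
    rw [e1]
    nlinarith [mul_le_mul_of_nonneg_left e2 (sq_nonneg (sqInner e z - sqInner v z))]
  have hint := integral_mono (μ := uniformSphere 𝕜 n) (hI (by fun_prop)) (hI (by fun_prop)) hpt
  rw [integral_sub (hI (by fun_prop)) (hI (by fun_prop)), integral_const_mul, integral_const_mul,
    integral_add (hI (by fun_prop)) (hI (by fun_prop)),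
    integral_sub (hI (by fun_prop)) (hI (by fun_prop)),
    integral_sub (hI (by fun_prop)) (hI (by fun_prop)), s1, s2] at hint
  have h1 := one_le_integral_sq_sub he hv hev
  linarith

/-- In expectation, the weight separates the direction `e` from all orthogonal directions. -/
theorem exists_weight_gap (hn : 1 ≤ n) (he : ‖e‖ = 1) :
    ∃ b : ℝ, 0 ≤ b ∧ (∀ v : EuclideanSpace 𝕜 (Fin n), ‖v‖ = 1 → inner 𝕜 e v = 0 →
      ∫ z, weight e z * sqInner v z ∂(uniformSphere 𝕜 n) = b) ∧
      b + 1 / 2 ^ 31 ≤ ∫ z, weight e z * sqInner e z ∂(uniformSphere 𝕜 n) := by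
  by_cases h : ∃ v : EuclideanSpace 𝕜 (Fin n), ‖v‖ = 1 ∧ inner 𝕜 e v = 0
  · obtain ⟨v, hv, hev⟩ := h
    refine ⟨_, integral_nonneg fun z => mul_nonneg (weight_nonneg e z) (sqInner_nonneg v z),
      fun v' hv' hev' => ?_, le_sub_iff_add_le'.1 (le_integral_weight_mul_sub he hv hev)⟩
    exact integral_inner_pair_eq he hv' hev' he hv hev
      fun a b => ‖a‖ ^ 2 / (1 + ‖a‖ ^ 2) * ‖b‖ ^ 2
  -- No unit vector is orthogonal to e, so b = 0 serves vacuously, and |⟨e, z⟩|² = ‖z‖² makes the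
  -- weighted moment explicit.
  · refine ⟨0, le_rfl, fun v hv hev => absurd ⟨v, hv, hev⟩ h, ?_⟩
    have hnorm : ∀ z : EuclideanSpace 𝕜 (Fin n), sqInner e z = ‖z‖ ^ 2 := by
      intro z
      have hz : z - (inner 𝕜 e z : 𝕜) • e = 0 := by
        by_contra hne
        refine h ⟨((‖z - (inner 𝕜 e z : 𝕜) • e‖⁻¹ : ℝ) : 𝕜) • (z - (inner 𝕜 e z : 𝕜) • e), ?_, ?_⟩
        · rw [norm_smul, RCLike.norm_ofReal, abs_of_nonneg (by positivity)]
          exact inv_mul_cancel₀ (norm_ne_zero_iff.2 hne)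
        · rw [inner_smul_right, inner_sub_right, inner_smul_right, inner_self_eq_norm_sq_to_K, he]
          simp
      rw [sub_eq_zero] at hz
      rw [sqInner]
      conv_rhs => rw [hz, norm_smul, he, mul_one]
    have := isProbabilityMeasure_uniformSphere (𝕜 := 𝕜) hn
    have hn' : (1 : ℝ) ≤ n := by exact_mod_cast hn
    have hconst : ∫ z, weight e z * sqInner e z ∂(uniformSphere 𝕜 n) =
        (n : ℝ) / (1 + n) * n := by
      have hae : ∀ᵐ z ∂(uniformSphere 𝕜 n), weight e z * sqInner e z = (n : ℝ) / (1 + n) * n := by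
        filter_upwards [ae_norm_eq_sqrt (𝕜 := 𝕜) (n := n)] with z hz
        rw [weight, hnorm, hz, Real.sq_sqrt (Nat.cast_nonneg _)]
      rw [integral_congr_ae hae]
      simp
    rw [hconst, zero_add, div_mul_eq_mul_div, le_div_iff₀ (by positivity)]
    nlinarith

/-- By 2xy ≤ x² + y² the exponential of a sum splits into two marginal ones at the price of halving
the exponent 1/16. It gives the Chernoff bound one exponential moment for all statistics. -/
theorem integral_exp_abs_le (hn : 1 ≤ n) (he : ‖e‖ ≤ 1) (hv : ‖v‖ ≤ 1)
    {G : EuclideanSpace 𝕜 (Fin n) → ℝ} (hG : Continuous G)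
    (h : ∀ z, |G z| ≤ sqInner e z + sqInner v z) :
    ∫ z, Real.exp (1 / 32 * |G z|) ∂(uniformSphere 𝕜 n) ≤ 40 := by
  have hI : ∀ {G : EuclideanSpace 𝕜 (Fin n) → ℝ}, Continuous G →
      Integrable G (uniformSphere 𝕜 n) := fun h => integrable_of_continuous hn h
  calc _ ≤ ∫ z, (1 / 2 * Real.exp (1 / 16 * sqInner e z) +
        1 / 2 * Real.exp (1 / 16 * sqInner v z)) ∂(uniformSphere 𝕜 n) := by
        refine integral_mono (hI (by fun_prop)) (hI (by fun_prop)) fun z => ?_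
        have h1 : Real.exp (1 / 32 * |G z|) ≤
            Real.exp (1 / 32 * sqInner e z) * Real.exp (1 / 32 * sqInner v z) := by
          rw [← Real.exp_add]
          exact Real.exp_le_exp.2 (by linarith [h z])
        have h2 : ∀ y : ℝ, Real.exp (1 / 16 * y) = Real.exp (1 / 32 * y) ^ 2 := by
          intro y
          rw [← Real.exp_nat_mul]
          ring_nf
        change _ ≤ 1 / 2 * Real.exp (1 / 16 * sqInner e z) +
          1 / 2 * Real.exp (1 / 16 * sqInner v z)
        rw [h2, h2]
        nlinarith [two_mul_le_add_sq (Real.exp (1 / 32 * sqInner e z))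
          (Real.exp (1 / 32 * sqInner v z))]
    _ = 1 / 2 * ∫ z, Real.exp (1 / 16 * sqInner e z) ∂(uniformSphere 𝕜 n) +
          1 / 2 * ∫ z, Real.exp (1 / 16 * sqInner v z) ∂(uniformSphere 𝕜 n) := by
        rw [integral_add (hI (by fun_prop)) (hI (by fun_prop)), integral_const_mul,
          integral_const_mul]
    _ ≤ _ := by linarith [integral_exp_sqInner_le hn he, integral_exp_sqInner_le hn hv]

end WeightedMoments

/-! ### Regular samples: from a net to all directions. -/

section Sampling

open Metric Module

variable {𝕜 : Type} [RCLike 𝕜] {n m : ℕ}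

/-- Deterministic conditions on the sensing vectors, relative to a unit vector `e`, up to an error
`θ`: empirical second moments are bounded, weighted ones separate `e` from its orthogonal
complement, and first absolute moments of the cross terms are bounded below. -/
structure IsRegularSample (a b c θ : ℝ) (e : EuclideanSpace 𝕜 (Fin n))
    (z : Fin m → EuclideanSpace 𝕜 (Fin n)) : Prop where
  sum_self : ∑ i, sqInner e (z i) ≤ 2 * m
  sum_orth : ∀ v, inner 𝕜 e v = 0 → ∑ i, sqInner v (z i) ≤ 2 * m * ‖v‖ ^ 2
  weight_self : m * (a - θ) ≤ ∑ i, weight e (z i) * sqInner e (z i)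
  weight_orth : ∀ v, inner 𝕜 e v = 0 →
    ∑ i, weight e (z i) * sqInner v (z i) ≤ m * (b + θ) * ‖v‖ ^ 2
  weight_cross : ∀ v, inner 𝕜 e v = 0 →
    |∑ i, weight e (z i) * crossRe e v (z i)| ≤ m * θ * ‖v‖
  abs_cross : ∀ v, inner 𝕜 e v = 0 → m * (c - θ) * ‖v‖ ≤ ∑ i, |crossRe e v (z i)|

/-- The statistics whose empirical means are controlled. -/
def statistic (e p : EuclideanSpace 𝕜 (Fin n)) : Fin 6 → EuclideanSpace 𝕜 (Fin n) → ℝ :=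
  -- Negated copies are included because the Chernoff bound controls upper deviations only.
  ![fun z => sqInner p z, fun z => weight e z * sqInner p z, fun z => -(weight e z * sqInner p z),
    fun z => weight e z * crossRe e p z, fun z => -(weight e z * crossRe e p z),
    fun z => -|crossRe e p z|]

theorem continuous_statistic (e p : EuclideanSpace 𝕜 (Fin n)) (k : Fin 6) :
    Continuous (statistic e p k) := by
  fin_cases k <;> (simp only [statistic]; dsimp; fun_prop)

theorem abs_statistic_le (e p : EuclideanSpace 𝕜 (Fin n)) (k : Fin 6)
    (z : EuclideanSpace 𝕜 (Fin n)) : |statistic e p k z| ≤ sqInner e z + sqInner p z := by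
  have he := sqInner_nonneg e z
  have hp := sqInner_nonneg p z
  have h1 : |sqInner p z| ≤ sqInner e z + sqInner p z := by rw [abs_of_nonneg hp]; linarith
  have h2 : |crossRe e p z| ≤ sqInner e z + sqInner p z := by
    linarith [two_mul_abs_crossRe_le e p z]
  have h3 := (abs_weight_mul_le e z (sqInner p z)).trans h1
  have h4 := (abs_weight_mul_le e z (crossRe e p z)).trans h2
  fin_cases k
  · exact h1
  · exact h3
  · exact (abs_neg _).trans_le h3
  · exact h4
  · exact (abs_neg _).trans_le h4
  · exact ((abs_neg _).trans (abs_abs _)).trans_le h2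

/-- With overwhelming probability the empirical means of all statistics over a finite set of
directions are close to their expectations. -/
theorem exists_rate_statistic {η : ℝ} (hη : 0 < η) :
    ∃ c : ℝ, 0 < c ∧ ∀ (𝕜 : Type) [RCLike 𝕜] (n m : ℕ), 1 ≤ n →
      ∀ (e : EuclideanSpace 𝕜 (Fin n)), ‖e‖ ≤ 1 → ∀ N : Finset (EuclideanSpace 𝕜 (Fin n)),
      (∀ p ∈ N, ‖p‖ ≤ 1) →
      ∃ A : Set (Fin m → EuclideanSpace 𝕜 (Fin n)), MeasurableSet A ∧
        (∀ z ∈ A, ∀ p ∈ N, ∀ k, ∑ i, statistic e p k (z i) ≤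
          m * (∫ y, statistic e p k y ∂(uniformSphere 𝕜 n) + η)) ∧
        ENNReal.ofReal (1 - N.card * 6 * Real.exp (-(c * m))) ≤ sensingLaw 𝕜 n m A := by
  obtain ⟨c, hc, hcher⟩ := exists_chernoff_rate (s := 1 / 32) (C := 40) (by norm_num)
    (by norm_num) hη
  refine ⟨c, hc, fun 𝕜 _ n m hn e he N hN => ?_⟩
  have := isProbabilityMeasure_uniformSphere (𝕜 := 𝕜) hn
  have hprob : IsProbabilityMeasure (sensingLaw 𝕜 n m) := by
    unfold sensingLaw
    infer_instance
  set B : EuclideanSpace 𝕜 (Fin n) × Fin 6 → Set (Fin m → EuclideanSpace 𝕜 (Fin n)) := fun q =>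
    {z | m * (∫ y, statistic e q.1 q.2 y ∂(uniformSphere 𝕜 n) + η) ≤
      ∑ i, statistic e q.1 q.2 (z i)} with hB
  have hBm : ∀ q, MeasurableSet (B q) := fun q => by
    refine measurableSet_le measurable_const (Continuous.measurable ?_)
    exact continuous_finsetSum _ fun i _ => (continuous_statistic e q.1 q.2).comp
      (continuous_apply i)
  set U := ⋃ q ∈ N ×ˢ (Finset.univ : Finset (Fin 6)), B q with hU
  have hUm : MeasurableSet U := Finset.measurableSet_biUnion _ fun q _ => hBm q
  have hBle : ∀ q ∈ N ×ˢ (Finset.univ : Finset (Fin 6)), sensingLaw 𝕜 n m (B q) ≤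
      ENNReal.ofReal (Real.exp (-(c * m))) := by
    rintro ⟨p, k⟩ hq
    have hp := hN p (Finset.mem_product.1 hq).1
    have hcont := continuous_statistic e p k
    exact hcher _ (uniformSphere 𝕜 n) (statistic e p k) hcont.measurable
      (integrable_of_continuous hn (by fun_prop))
      (integral_exp_abs_le hn he hp hcont (abs_statistic_le e p k)) _ le_rfl m
  have hUle : sensingLaw 𝕜 n m U ≤ ENNReal.ofReal (N.card * 6 * Real.exp (-(c * m))) := by
    refine (measure_biUnion_finset_le _ _).trans ((Finset.sum_le_card_nsmul _ _ _ hBle).trans_eq ?_)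
    rw [Finset.card_product, Finset.card_univ, Fintype.card_fin, nsmul_eq_mul,
      ENNReal.ofReal_mul (by positivity)]
    congr 1
    rw [← ENNReal.ofReal_natCast, Nat.cast_mul, Nat.cast_ofNat]
  refine ⟨Uᶜ, hUm.compl, fun z hz p hp k => ?_, ?_⟩
  · have : z ∉ B (p, k) := fun hmem => hz (Set.mem_biUnion
      (by simpa using hp : (p, k) ∈ (N ×ˢ (Finset.univ : Finset (Fin 6)))) hmem)
    exact (not_le.1 this).le
  · rw [prob_compl_eq_one_sub hUm, ENNReal.ofReal_sub _ (by positivity), ENNReal.ofReal_one]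
    exact tsub_le_tsub_left hUle 1

theorem exists_unit_smul_of_ne_zero {e v : EuclideanSpace 𝕜 (Fin n)} (hv : v ≠ 0)
    (hev : inner 𝕜 e v = 0) :
    ∃ u : EuclideanSpace 𝕜 (Fin n), ‖u‖ = 1 ∧ inner 𝕜 e u = 0 ∧ v = ((‖v‖ : ℝ) : 𝕜) • u := by
  have h : ‖v‖ ≠ 0 := norm_ne_zero_iff.2 hv
  refine ⟨((‖v‖⁻¹ : ℝ) : 𝕜) • v, ?_, ?_, ?_⟩
  · rw [norm_smul, RCLike.norm_ofReal, abs_of_nonneg (by positivity)]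
    exact inv_mul_cancel₀ h
  · rw [inner_smul_right, hev, mul_zero]
  · rw [smul_smul, ← RCLike.ofReal_mul, mul_inv_cancel₀ h, RCLike.ofReal_one, one_smul]

theorem sqInner_real_smul (r : ℝ) (v z : EuclideanSpace 𝕜 (Fin n)) :
    sqInner ((r : 𝕜) • v) z = r ^ 2 * sqInner v z := by
  rw [sqInner_smul, RCLike.norm_ofReal, sq_abs]

/-- Young's inequality (x + d)² ≤ (1 + 1/4) x² + (1 + 4) d²: the net point is favoured, the small
difference pays. -/
theorem sqInner_le_add (u p z : EuclideanSpace 𝕜 (Fin n)) :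
    sqInner u z ≤ 5 / 4 * sqInner p z + 5 * sqInner (u - p) z := by
  have h : sqInner u z ≤ (‖(inner 𝕜 p z : 𝕜)‖ + ‖(inner 𝕜 (u - p) z : 𝕜)‖) ^ 2 := by
    rw [sqInner]
    gcongr
    rw [inner_sub_left]
    simpa using norm_add_le (inner 𝕜 p z : 𝕜) (inner 𝕜 u z - inner 𝕜 p z)
  refine h.trans ?_
  rw [sqInner, sqInner]
  nlinarith [sq_nonneg (‖(inner 𝕜 p z : 𝕜)‖ - 4 * ‖(inner 𝕜 (u - p) z : 𝕜)‖)]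

/-- Factor x² - y² and apply the arithmetic-geometric inequality with parameter δ. For ‖u - p‖ ≤ δ
the first term averages to order δ²/δ, so both terms are of order δ. -/
theorem sqInner_sub_sqInner_le {δ : ℝ} (hδ : 0 < δ) (u p z : EuclideanSpace 𝕜 (Fin n)) :
    sqInner u z - sqInner p z ≤ 1 / (2 * δ) * sqInner (u - p) z +
      δ * (sqInner u z + sqInner p z) := by
  have h : ‖(inner 𝕜 u z : 𝕜)‖ - ‖(inner 𝕜 p z : 𝕜)‖ ≤ ‖(inner 𝕜 (u - p) z : 𝕜)‖ := by
    rw [inner_sub_left]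
    exact norm_sub_norm_le _ _
  rw [sqInner, sqInner, sqInner]
  set x := ‖(inner 𝕜 u z : 𝕜)‖
  set y := ‖(inner 𝕜 p z : 𝕜)‖
  set d := ‖(inner 𝕜 (u - p) z : 𝕜)‖
  have hx : 0 ≤ x := norm_nonneg _
  have hy : 0 ≤ y := norm_nonneg _
  have h1 : x ^ 2 - y ^ 2 ≤ d * (x + y) := by nlinarith
  have h2 : d * (x + y) ≤ 1 / (2 * δ) * d ^ 2 + δ / 2 * (x + y) ^ 2 := by
    have : 1 / (2 * δ) * d ^ 2 + δ / 2 * (x + y) ^ 2 - d * (x + y) =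
        1 / (2 * δ) * (d - δ * (x + y)) ^ 2 := by
      field_simp
      ring
    have h3 : 0 ≤ 1 / (2 * δ) * (d - δ * (x + y)) ^ 2 := by positivity
    linarith
  nlinarith [mul_nonneg hδ.le (sq_nonneg (x - y))]

theorem abs_crossRe_le_add {δ : ℝ} (hδ : 0 < δ) (e v z : EuclideanSpace 𝕜 (Fin n)) :
    |crossRe e v z| ≤ δ / 2 * sqInner e z + 1 / (2 * δ) * sqInner v z := by
  refine (abs_crossRe_le e v z).trans ?_
  rw [sqInner, sqInner]
  set x := ‖(inner 𝕜 e z : 𝕜)‖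
  set y := ‖(inner 𝕜 v z : 𝕜)‖
  have : δ / 2 * x ^ 2 + 1 / (2 * δ) * y ^ 2 - x * y = 1 / (2 * δ) * (δ * x - y) ^ 2 := by
    field_simp
    ring
  have h3 : 0 ≤ 1 / (2 * δ) * (δ * x - y) ^ 2 := by positivity
  linarith

/-- Upper bound for the empirical second moments in all directions orthogonal to `e` from a
bound on a net. -/
theorem sum_sqInner_le_of_net {e : EuclideanSpace 𝕜 (Fin n)}
    {N : Finset (EuclideanSpace 𝕜 (Fin n))} (hNe : ∀ p ∈ N, inner 𝕜 e p = 0)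
    (hN : ∀ u : EuclideanSpace 𝕜 (Fin n), ‖u‖ = 1 → inner 𝕜 e u = 0 → ∃ p ∈ N, ‖u - p‖ ≤ 1 / 6)
    (z : Fin m → EuclideanSpace 𝕜 (Fin n))
    (h : ∀ p ∈ N, ∑ i, sqInner p (z i) ≤ m * (5 / 4)) (v : EuclideanSpace 𝕜 (Fin n))
    (hv : inner 𝕜 e v = 0) : ∑ i, sqInner v (z i) ≤ 2 * m * ‖v‖ ^ 2 := by
  rcases eq_or_ne v 0 with rfl | hv0
  · simp [sqInner]
  obtain ⟨u, hu, heu, hvu⟩ := exists_unit_smul_of_ne_zero hv0 hv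
  have hscale : ∀ {w : EuclideanSpace 𝕜 (Fin n)} {r : ℝ}, ∑ i, sqInner ((r : 𝕜) • w) (z i) =
      r ^ 2 * ∑ i, sqInner w (z i) := by
    intro w r
    simp_rw [sqInner_real_smul, Finset.mul_sum]
  set S : Set (EuclideanSpace 𝕜 (Fin n)) := sphere 0 1 ∩ {w | inner 𝕜 e w = 0} with hS
  have hScomp : IsCompact S := (isCompact_sphere 0 1).inter_right
    (isClosed_eq (continuous_const.inner continuous_id) continuous_const)
  have hcont : Continuous fun w : EuclideanSpace 𝕜 (Fin n) => ∑ i, sqInner w (z i) := by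
    unfold sqInner
    fun_prop
  -- Bootstrapping at a maximizer w of the form on the unit sphere of the complement of e, with
  -- maximum A: a net point p within 1/6 gives A ≤ (5/4)(5/4) m + (5/36) A, hence A ≤ 2m.
  obtain ⟨w, ⟨hw1, hw2⟩, hmax⟩ := hScomp.exists_isMaxOn ⟨u, by simpa using hu, heu⟩
    hcont.continuousOn
  have hw1' : ‖w‖ = 1 := by simpa using hw1
  set A := ∑ i, sqInner w (z i) with hA
  have hA0 : 0 ≤ A := Finset.sum_nonneg fun i _ => sqInner_nonneg _ _
  have hall : ∀ y : EuclideanSpace 𝕜 (Fin n), inner 𝕜 e y = 0 →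
      ∑ i, sqInner y (z i) ≤ ‖y‖ ^ 2 * A := by
    intro y hy
    rcases eq_or_ne y 0 with rfl | hy0
    · simp [sqInner]
    obtain ⟨y', hy', hey', hyy'⟩ := exists_unit_smul_of_ne_zero hy0 hy
    conv_lhs => rw [hyy', hscale]
    have : ∑ i, sqInner y' (z i) ≤ A := hmax ⟨by simpa using hy', hey'⟩
    gcongr
  obtain ⟨p, hp, hwp⟩ := hN w hw1' hw2
  have hAle : A ≤ 5 / 4 * ∑ i, sqInner p (z i) + 5 * ∑ i, sqInner (w - p) (z i) := by
    rw [Finset.mul_sum, Finset.mul_sum, ← Finset.sum_add_distrib]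
    exact Finset.sum_le_sum fun i _ => sqInner_le_add w p (z i)
  have h1 := hall (w - p) (by rw [inner_sub_right, hw2, hNe p hp, sub_zero])
  have h2 : ‖w - p‖ ^ 2 ≤ (1 / 6) ^ 2 := by gcongr
  have h3 : ‖w - p‖ ^ 2 * A ≤ (1 / 6) ^ 2 * A := by gcongr
  have h4 := h p hp
  have hm : (0 : ℝ) ≤ m := Nat.cast_nonneg m
  have hA2 : A ≤ 2 * m := by linarith
  calc ∑ i, sqInner v (z i) ≤ ‖v‖ ^ 2 * A := hall v hv
    _ ≤ ‖v‖ ^ 2 * (2 * m) := by gcongr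
    _ = _ := by ring

/-- Each hypothesis has the shape mean + δ, including `0 + δ` and `-0 + δ`, so that bounds on the
statistics rewrite into it. Moving from a net point to a nearby direction loses most in
`weight_orth`: δ + δ + 4δ, whence the factor 6. -/
theorem isRegularSample_of_net {a b c δ : ℝ} (hδ : 0 < δ) (hδ1 : δ ≤ 1 / 6)
    {e : EuclideanSpace 𝕜 (Fin n)}
    {N : Finset (EuclideanSpace 𝕜 (Fin n))} (hN1 : ∀ p ∈ N, ‖p‖ = 1)
    (hNe : ∀ p ∈ N, inner 𝕜 e p = 0)
    (hN : ∀ u : EuclideanSpace 𝕜 (Fin n), ‖u‖ = 1 → inner 𝕜 e u = 0 → ∃ p ∈ N, ‖u - p‖ ≤ δ)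
    (z : Fin m → EuclideanSpace 𝕜 (Fin n))
    (hself : ∑ i, sqInner e (z i) ≤ m * (1 + δ))
    (hwself : ∑ i, -(weight e (z i) * sqInner e (z i)) ≤ m * (-a + δ))
    (horth : ∀ p ∈ N, ∑ i, sqInner p (z i) ≤ m * (1 + δ))
    (hworth : ∀ p ∈ N, ∑ i, weight e (z i) * sqInner p (z i) ≤ m * (b + δ))
    (hcross : ∀ p ∈ N, ∑ i, weight e (z i) * crossRe e p (z i) ≤ m * (0 + δ))
    (hcross' : ∀ p ∈ N, ∑ i, -(weight e (z i) * crossRe e p (z i)) ≤ m * (-0 + δ))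
    (habs : ∀ p ∈ N, ∑ i, -|crossRe e p (z i)| ≤ m * (-c + δ)) :
    IsRegularSample a b c (6 * δ) e z := by
  have hm : (0 : ℝ) ≤ m := Nat.cast_nonneg m
  have hsum_self : ∑ i, sqInner e (z i) ≤ 2 * m := by nlinarith
  have hsum := sum_sqInner_le_of_net hNe
    (fun u hu heu => (hN u hu heu).imp fun p hp => ⟨hp.1, hp.2.trans hδ1⟩) z
    (fun p hp => (horth p hp).trans (by gcongr; linarith))
  have hdiff : ∀ u : EuclideanSpace 𝕜 (Fin n), inner 𝕜 e u = 0 → ∀ p ∈ N, ‖u - p‖ ≤ δ →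
      1 / (2 * δ) * ∑ i, sqInner (u - p) (z i) ≤ m * δ := by
    intro u hu p hp hup
    have h1 := hsum (u - p) (by rw [inner_sub_right, hu, hNe p hp, sub_zero])
    have h2 : ‖u - p‖ ^ 2 ≤ δ ^ 2 := by gcongr
    calc _ ≤ 1 / (2 * δ) * (2 * m * δ ^ 2) := by
          gcongr
          exact h1.trans (by gcongr)
      _ = m * δ := by field_simp
  have hdiff_cross : ∀ u : EuclideanSpace 𝕜 (Fin n), inner 𝕜 e u = 0 → ∀ p ∈ N, ‖u - p‖ ≤ δ →
      ∑ i, |crossRe e (u - p) (z i)| ≤ m * (2 * δ) := by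
    intro u hu p hp hup
    calc _ ≤ ∑ i, (δ / 2 * sqInner e (z i) + 1 / (2 * δ) * sqInner (u - p) (z i)) :=
          Finset.sum_le_sum fun i _ => abs_crossRe_le_add hδ e (u - p) (z i)
      _ = δ / 2 * ∑ i, sqInner e (z i) + 1 / (2 * δ) * ∑ i, sqInner (u - p) (z i) := by
          rw [Finset.sum_add_distrib, Finset.mul_sum, Finset.mul_sum]
      _ ≤ δ / 2 * (2 * m) + m * δ := by
          exact add_le_add (mul_le_mul_of_nonneg_left hsum_self (by positivity))
            (hdiff u hu p hp hup)
      _ = _ := by ring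
  refine ⟨hsum_self, hsum, ?_, fun v hv => ?_, fun v hv => ?_, fun v hv => ?_⟩
  · rw [Finset.sum_neg_distrib] at hwself
    nlinarith
  · rcases eq_or_ne v 0 with rfl | hv0
    · simp [sqInner]
    obtain ⟨u, hu, heu, hvu⟩ := exists_unit_smul_of_ne_zero hv0 hv
    obtain ⟨p, hp, hup⟩ := hN u hu heu
    have key : ∑ i, weight e (z i) * sqInner u (z i) ≤ m * (b + 6 * δ) := by
      have h1 : ∑ i, weight e (z i) * sqInner u (z i) ≤
          ∑ i, weight e (z i) * sqInner p (z i) + (1 / (2 * δ) * ∑ i, sqInner (u - p) (z i) +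
            δ * (∑ i, sqInner u (z i) + ∑ i, sqInner p (z i))) := by
        rw [← Finset.sum_add_distrib, Finset.mul_sum, Finset.mul_sum, ← Finset.sum_add_distrib,
          ← Finset.sum_add_distrib]
        refine Finset.sum_le_sum fun i _ => ?_
        have h2 := sqInner_sub_sqInner_le hδ u p (z i)
        have h3 : weight e (z i) * (sqInner u (z i) - sqInner p (z i)) ≤
            1 / (2 * δ) * sqInner (u - p) (z i) + δ * (sqInner u (z i) + sqInner p (z i)) := by
          have h4 : 0 ≤ 1 / (2 * δ) * sqInner (u - p) (z i) +
              δ * (sqInner u (z i) + sqInner p (z i)) := by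
            have := sqInner_nonneg (u - p) (z i)
            have := sqInner_nonneg u (z i)
            have := sqInner_nonneg p (z i)
            positivity
          nlinarith [weight_nonneg e (z i), weight_le_one e (z i)]
        linarith
      have h2 := hsum u heu
      have h3 := hsum p (hNe p hp)
      rw [hu] at h2
      rw [hN1 p hp] at h3
      have h4 : δ * (∑ i, sqInner u (z i) + ∑ i, sqInner p (z i)) ≤ δ * (4 * m) := by
        gcongr
        linarith
      have h5 := hdiff u heu p hp hup
      have h6 := hworth p hp
      linarith
    calc ∑ i, weight e (z i) * sqInner v (z i)
        = (∑ i, weight e (z i) * sqInner u (z i)) * ‖v‖ ^ 2 := by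
          rw [Finset.sum_mul]
          refine Finset.sum_congr rfl fun i _ => ?_
          conv_lhs => rw [hvu, sqInner_real_smul]
          ring
      _ ≤ _ := by gcongr
  · rcases eq_or_ne v 0 with rfl | hv0
    · simp [crossRe]
    obtain ⟨u, hu, heu, hvu⟩ := exists_unit_smul_of_ne_zero hv0 hv
    obtain ⟨p, hp, hup⟩ := hN u hu heu
    have key : |∑ i, weight e (z i) * crossRe e u (z i)| ≤ m * (6 * δ) := by
      have h1 : ∑ i, weight e (z i) * crossRe e u (z i) =
          ∑ i, weight e (z i) * crossRe e p (z i) +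
            ∑ i, weight e (z i) * crossRe e (u - p) (z i) := by
        rw [← Finset.sum_add_distrib]
        refine Finset.sum_congr rfl fun i _ => ?_
        rw [crossRe_sub_right]
        ring
      have h2 : |∑ i, weight e (z i) * crossRe e (u - p) (z i)| ≤ m * (2 * δ) :=
        (Finset.abs_sum_le_sum_abs _ _).trans ((Finset.sum_le_sum fun i _ =>
          abs_weight_mul_le e (z i) _).trans (hdiff_cross u heu p hp hup))
      have h3 := hcross p hp
      have h4 := hcross' p hp
      rw [Finset.sum_neg_distrib] at h4
      have h5 := abs_le.1 h2
      rw [h1, abs_le]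
      constructor <;> nlinarith [mul_nonneg hm hδ.le]
    calc |∑ i, weight e (z i) * crossRe e v (z i)|
        = |(∑ i, weight e (z i) * crossRe e u (z i)) * ‖v‖| := by
          congr 1
          rw [Finset.sum_mul]
          refine Finset.sum_congr rfl fun i _ => ?_
          conv_lhs => rw [hvu, crossRe_real_smul_right]
          ring
      _ = |∑ i, weight e (z i) * crossRe e u (z i)| * ‖v‖ := by
          rw [abs_mul, abs_of_nonneg (norm_nonneg v)]
      _ ≤ _ := by gcongr
  · rcases eq_or_ne v 0 with rfl | hv0
    · simp [crossRe]
    obtain ⟨u, hu, heu, hvu⟩ := exists_unit_smul_of_ne_zero hv0 hv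
    obtain ⟨p, hp, hup⟩ := hN u hu heu
    have key : m * (c - 6 * δ) ≤ ∑ i, |crossRe e u (z i)| := by
      have h1 : ∑ i, |crossRe e p (z i)| ≤
          ∑ i, |crossRe e u (z i)| + ∑ i, |crossRe e (u - p) (z i)| := by
        rw [← Finset.sum_add_distrib]
        refine Finset.sum_le_sum fun i _ => ?_
        rw [crossRe_sub_right]
        have := abs_sub_abs_le_abs_sub (crossRe e p (z i)) (crossRe e u (z i))
        rw [abs_sub_comm] at this
        linarith
      have h2 := hdiff_cross u heu p hp hup
      have h3 := habs p hp
      rw [Finset.sum_neg_distrib] at h3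
      nlinarith [mul_nonneg hm hδ.le]
    calc m * (c - 6 * δ) * ‖v‖ ≤ (∑ i, |crossRe e u (z i)|) * ‖v‖ := by gcongr
      _ = _ := by
          rw [Finset.sum_mul]
          refine Finset.sum_congr rfl fun i _ => ?_
          conv_rhs => rw [hvu, crossRe_real_smul_right, abs_mul, abs_of_nonneg (norm_nonneg v)]
          ring

end Sampling

/-! ### Probability of a regular sample. -/

section SamplingEvent

open Metric Module

/-- Random sensing vectors form a regular sample with overwhelming probability as soon as their
number is at least a large multiple of the dimension. -/
theorem exists_isRegularSample {θ : ℝ} (hθ : 0 < θ) :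
    ∃ K γ : ℝ, 0 < K ∧ 0 < γ ∧ ∀ (𝕜 : Type) [RCLike 𝕜] (n m : ℕ), 1 ≤ n → K * n ≤ m →
      ∀ e : EuclideanSpace 𝕜 (Fin n), ‖e‖ = 1 → ∃ a b : ℝ, 0 ≤ b ∧ b + 1 / 2 ^ 31 ≤ a ∧
        ∃ A : Set (Fin m → EuclideanSpace 𝕜 (Fin n)), MeasurableSet A ∧
          (∀ z ∈ A, IsRegularSample a b (1 / 2 ^ 18) θ e z) ∧
          ENNReal.ofReal (1 - Real.exp (-(γ * m))) ≤ sensingLaw 𝕜 n m A := by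
  set δ : ℝ := min θ 1 / 6 with hδdef
  have hδ : 0 < δ := by positivity
  have hδ1 : δ ≤ 1 / 6 := by
    have := min_le_right θ 1
    linarith
  have hδθ : 6 * δ ≤ θ := by
    have := min_le_left θ 1
    linarith
  obtain ⟨c, hc, hrate⟩ := exists_rate_statistic hδ
  set R : ℝ := 1 + 2 / δ with hR
  have hR1 : 1 ≤ R := by
    have : 0 < 2 / δ := by positivity
    linarith
  have hlogR : 0 ≤ Real.log R := Real.log_nonneg hR1
  -- Net and e together have at most 2 R^(2n) points, the real dimension being at most 2n. Six
  -- statistics each give a union bound of 12 R^(2n) ≤ exp((12 + 2 log R) n) terms; K is such that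
  -- half of the exponent c m absorbs this.
  refine ⟨2 * (12 + 2 * Real.log R) / c, c / 2, by positivity, by positivity,
    fun 𝕜 _ n m hn hm e he => ?_⟩
  classical
  obtain ⟨N, hNS, hNcard, hNnet⟩ := exists_finset_net hδ
    {u : EuclideanSpace 𝕜 (Fin n) | ‖u‖ = 1 ∧ inner 𝕜 e u = 0} (fun u hu => hu.1.le)
  obtain ⟨b, hb0, hb, hgap⟩ := exists_weight_gap hn he
  obtain ⟨A, hAm, hA, hAp⟩ := hrate 𝕜 n m hn e he.le (insert e N) (by
    intro p hp
    rcases Finset.mem_insert.1 hp with rfl | hp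
    exacts [he.le, (hNS p hp).1.le])
  refine ⟨_, b, hb0, hgap, A, hAm, fun z hz => ?_, ?_⟩
  · have hstat := fun p (hp : p ∈ N) => hA z hz p (Finset.mem_insert_of_mem hp)
    have hself := hA z hz e (Finset.mem_insert_self e N)
    have hm0 : (0 : ℝ) ≤ m := Nat.cast_nonneg m
    have hreg : IsRegularSample (∫ z, weight e z * sqInner e z ∂(uniformSphere 𝕜 n)) b (1 / 2 ^ 18)
        (6 * δ) e z := by
      refine isRegularSample_of_net hδ hδ1 (fun p hp => (hNS p hp).1) (fun p hp => (hNS p hp).2)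
        (fun u hu heu => hNnet u ⟨hu, heu⟩) z ?_ ?_ (fun p hp => ?_) (fun p hp => ?_)
        (fun p hp => ?_) (fun p hp => ?_) (fun p hp => ?_)
      · rw [← integral_sqInner hn he]
        exact hself 0
      · rw [← integral_neg]
        exact hself 2
      · rw [← integral_sqInner hn (hNS p hp).1]
        exact hstat p hp 0
      · rw [← hb p (hNS p hp).1 (hNS p hp).2]
        exact hstat p hp 1
      · rw [← integral_weight_mul_crossRe he (hNS p hp).1 (hNS p hp).2]
        exact hstat p hp 3
      · rw [← integral_weight_mul_crossRe he (hNS p hp).1 (hNS p hp).2, ← integral_neg]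
        exact hstat p hp 4
      · refine (hstat p hp 5).trans (mul_le_mul_of_nonneg_left ?_ hm0)
        have h1 : ∫ y, statistic e p 5 y ∂(uniformSphere 𝕜 n) =
            -∫ y, |crossRe e p y| ∂(uniformSphere 𝕜 n) := integral_neg _
        rw [h1]
        linarith [le_integral_abs_crossRe he (hNS p hp).1 (hNS p hp).2]
    refine ⟨hreg.sum_self, hreg.sum_orth, ?_, fun v hv => ?_, fun v hv => ?_, fun v hv => ?_⟩
    · exact le_trans (by gcongr) hreg.weight_self
    · exact (hreg.weight_orth v hv).trans (by gcongr)
    · exact (hreg.weight_cross v hv).trans (by gcongr)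
    · exact le_trans (by gcongr) (hreg.abs_cross v hv)
  · refine le_trans (ENNReal.ofReal_le_ofReal ?_) hAp
    have hn1 : (1 : ℝ) ≤ n := by exact_mod_cast hn
    have hcard : (((insert e N).card : ℕ) : ℝ) ≤ 2 * R ^ (2 * n) := by
      have h1 : (((insert e N).card : ℕ) : ℝ) ≤ N.card + 1 := by
        exact_mod_cast Finset.card_insert_le e N
      have h2 : R ^ finrank ℝ (EuclideanSpace 𝕜 (Fin n)) ≤ R ^ (2 * n) :=
        pow_le_pow_right₀ hR1 finrank_real_le
      have h3 : 1 ≤ R ^ (2 * n) := one_le_pow₀ hR1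
      linarith
    have h12 : (12 : ℝ) ≤ Real.exp (12 * n) := by
      have := Real.add_one_le_exp (12 * n : ℝ)
      linarith
    have hRexp : R ^ (2 * n) = Real.exp (2 * Real.log R * n) := by
      rw [← Real.exp_log (lt_of_lt_of_le one_pos hR1), ← Real.exp_nat_mul, Real.log_exp]
      push_cast
      ring_nf
    have hfinal : ((insert e N).card : ℝ) * 6 * Real.exp (-(c * m)) ≤
        Real.exp (-(c / 2 * m)) := by
      calc ((insert e N).card : ℝ) * 6 * Real.exp (-(c * m))
          ≤ 2 * R ^ (2 * n) * 6 * Real.exp (-(c * m)) := by gcongr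
        _ = 12 * R ^ (2 * n) * Real.exp (-(c * m)) := by ring
        _ ≤ Real.exp (12 * n) * R ^ (2 * n) * Real.exp (-(c * m)) := by gcongr
        _ = Real.exp ((12 + 2 * Real.log R) * n - c * m) := by
            rw [hRexp, ← Real.exp_add, ← Real.exp_add]
            ring_nf
        _ ≤ _ := by
            refine Real.exp_le_exp.2 ?_
            rw [div_mul_eq_mul_div, div_le_iff₀ hc] at hm
            linarith
    linarith

end SamplingEvent

/-! ### Matrix algebra in the Frobenius inner product. -/

section Matrices

variable {𝕜 : Type} [RCLike 𝕜] {n m : ℕ}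

/-- The rank-one matrix `u v^*`. -/
def outerProd (u v : EuclideanSpace 𝕜 (Fin n)) : Matrix (Fin n) (Fin n) 𝕜 :=
  Matrix.vecMulVec u.ofLp (star v.ofLp)

/-- The entries of a matrix as a Euclidean vector. -/
def entries (X : Matrix (Fin n) (Fin n) 𝕜) : EuclideanSpace 𝕜 (Fin n × Fin n) :=
  WithLp.toLp 2 fun p => X p.1 p.2

/-- The real part of the quadratic form of a matrix. -/
def quadForm (X : Matrix (Fin n) (Fin n) 𝕜) (z : EuclideanSpace 𝕜 (Fin n)) : ℝ :=
  RCLike.re (dotProduct (star z.ofLp) (X.mulVec z.ofLp))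

theorem outer_eq_outerProd (v : EuclideanSpace 𝕜 (Fin n)) : outer v = outerProd v v := rfl

theorem outerProd_apply (u v : EuclideanSpace 𝕜 (Fin n)) (i j : Fin n) :
    outerProd u v i j = u i * starRingEnd 𝕜 (v j) := rfl

theorem frobeniusNorm_eq_norm_entries (X : Matrix (Fin n) (Fin n) 𝕜) :
    frobeniusNorm X = ‖entries X‖ := by
  rw [frobeniusNorm, EuclideanSpace.norm_eq, Fintype.sum_prod_type]
  rfl

theorem entries_add (X Y : Matrix (Fin n) (Fin n) 𝕜) :
    entries (X + Y) = entries X + entries Y := rfl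

theorem entries_sub (X Y : Matrix (Fin n) (Fin n) 𝕜) :
    entries (X - Y) = entries X - entries Y := rfl

theorem entries_smul (c : 𝕜) (X : Matrix (Fin n) (Fin n) 𝕜) :
    entries (c • X) = c • entries X := rfl

theorem entries_sum {ι : Type*} (s : Finset ι) (X : ι → Matrix (Fin n) (Fin n) 𝕜) :
    entries (∑ k ∈ s, X k) = ∑ k ∈ s, entries (X k) := by
  classical
  induction s using Finset.induction_on with
  | empty => simp only [Finset.sum_empty]; rfl
  | insert a s ha ih => rw [Finset.sum_insert ha, Finset.sum_insert ha, entries_add, ih]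

theorem inner_entries (X Y : Matrix (Fin n) (Fin n) 𝕜) :
    (inner 𝕜 (entries X) (entries Y) : 𝕜) = ∑ i, ∑ j, Y i j * starRingEnd 𝕜 (X i j) := by
  rw [PiLp.inner_apply, Fintype.sum_prod_type]
  rfl

theorem inner_eq_sum (u v : EuclideanSpace 𝕜 (Fin n)) :
    (inner 𝕜 u v : 𝕜) = ∑ i, v i * starRingEnd 𝕜 (u i) := by
  rw [PiLp.inner_apply]
  rfl

theorem inner_entries_outerProd (u v u' v' : EuclideanSpace 𝕜 (Fin n)) :
    (inner 𝕜 (entries (outerProd u v)) (entries (outerProd u' v')) : 𝕜) =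
      inner 𝕜 u u' * inner 𝕜 v' v := by
  rw [inner_entries, inner_eq_sum, inner_eq_sum, Finset.sum_mul_sum]
  refine Finset.sum_congr rfl fun i _ => Finset.sum_congr rfl fun j _ => ?_
  simp only [outerProd_apply, map_mul, RCLike.conj_conj]
  ring

theorem norm_entries_outerProd (u v : EuclideanSpace 𝕜 (Fin n)) :
    ‖entries (outerProd u v)‖ = ‖u‖ * ‖v‖ := by
  refine (sq_eq_sq₀ (norm_nonneg _) (by positivity)).1 ?_
  have h := inner_self_eq_norm_sq (𝕜 := 𝕜) (entries (outerProd u v))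
  rw [inner_entries_outerProd, inner_self_eq_norm_sq_to_K, inner_self_eq_norm_sq_to_K,
    ← RCLike.ofReal_pow, ← RCLike.ofReal_pow, ← RCLike.ofReal_mul, RCLike.ofReal_re] at h
  rw [mul_pow]
  exact h.symm

/-- As a Frobenius inner product with z z^*, the quadratic form inherits linearity and the
Cauchy–Schwarz inequality. -/
theorem quadForm_eq_re_inner_entries (X : Matrix (Fin n) (Fin n) 𝕜)
    (z : EuclideanSpace 𝕜 (Fin n)) :
    quadForm X z = RCLike.re (inner 𝕜 (entries (outerProd z z)) (entries X) : 𝕜) := by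
  rw [inner_entries, quadForm, dotProduct]
  congr 1
  refine Finset.sum_congr rfl fun i _ => ?_
  rw [Matrix.mulVec, dotProduct, Finset.mul_sum]
  refine Finset.sum_congr rfl fun j _ => ?_
  rw [outerProd_apply, map_mul, RCLike.conj_conj, Pi.star_apply, RCLike.star_def]
  ring

theorem abs_quadForm_le (X : Matrix (Fin n) (Fin n) 𝕜) (z : EuclideanSpace 𝕜 (Fin n)) :
    |quadForm X z| ≤ frobeniusNorm X * ‖z‖ ^ 2 := by
  rw [quadForm_eq_re_inner_entries]
  refine (RCLike.abs_re_le_norm _).trans ((norm_inner_le_norm _ _).trans_eq ?_)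
  rw [norm_entries_outerProd, frobeniusNorm_eq_norm_entries]
  ring

theorem quadForm_add (X Y : Matrix (Fin n) (Fin n) 𝕜) (z : EuclideanSpace 𝕜 (Fin n)) :
    quadForm (X + Y) z = quadForm X z + quadForm Y z := by
  simp only [quadForm_eq_re_inner_entries, entries_add, inner_add_right, map_add]

theorem quadForm_sub (X Y : Matrix (Fin n) (Fin n) 𝕜) (z : EuclideanSpace 𝕜 (Fin n)) :
    quadForm (X - Y) z = quadForm X z - quadForm Y z := by
  simp only [quadForm_eq_re_inner_entries, entries_sub, inner_sub_right, map_sub]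

theorem quadForm_real_smul (r : ℝ) (X : Matrix (Fin n) (Fin n) 𝕜)
    (z : EuclideanSpace 𝕜 (Fin n)) : quadForm ((r : 𝕜) • X) z = r * quadForm X z := by
  simp only [quadForm_eq_re_inner_entries, entries_smul, inner_smul_right, RCLike.re_ofReal_mul]

theorem quadForm_sum {ι : Type*} (s : Finset ι) (X : ι → Matrix (Fin n) (Fin n) 𝕜)
    (z : EuclideanSpace 𝕜 (Fin n)) : quadForm (∑ k ∈ s, X k) z = ∑ k ∈ s, quadForm (X k) z := by
  simp only [quadForm_eq_re_inner_entries, entries_sum, inner_sum, map_sum]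

theorem quadForm_outerProd (u v z : EuclideanSpace 𝕜 (Fin n)) :
    quadForm (outerProd u v) z = crossRe u v z := by
  rw [quadForm_eq_re_inner_entries, inner_entries_outerProd, crossRe, ← inner_conj_symm z u]

theorem crossRe_self (v z : EuclideanSpace 𝕜 (Fin n)) : crossRe v v z = sqInner v z := by
  rw [crossRe, sqInner, RCLike.conj_mul, ← RCLike.ofReal_pow, RCLike.ofReal_re]

theorem crossRe_comm (u v z : EuclideanSpace 𝕜 (Fin n)) : crossRe u v z = crossRe v u z := by
  rw [crossRe, crossRe, ← RCLike.conj_re, map_mul, RCLike.conj_conj, mul_comm]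

theorem quadForm_outer (v z : EuclideanSpace 𝕜 (Fin n)) : quadForm (outer v) z = sqInner v z := by
  rw [outer_eq_outerProd, quadForm_outerProd, crossRe_self]

theorem trace_outerProd (u v : EuclideanSpace 𝕜 (Fin n)) :
    (outerProd u v).trace = inner 𝕜 v u := by
  rw [inner_eq_sum]
  rfl

theorem re_trace_outer (v : EuclideanSpace 𝕜 (Fin n)) :
    RCLike.re (outer v).trace = ‖v‖ ^ 2 := by
  rw [outer_eq_outerProd, trace_outerProd, inner_self_eq_norm_sq]

theorem outer_smul (c : 𝕜) (v : EuclideanSpace 𝕜 (Fin n)) :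
    outer (c • v) = ((‖c‖ ^ 2 : ℝ) : 𝕜) • outer v := by
  ext i j
  simp only [outer_eq_outerProd, outerProd_apply, Matrix.smul_apply, PiLp.smul_apply, smul_eq_mul,
    map_mul, RCLike.ofReal_pow, ← RCLike.mul_conj]
  ring

theorem posSemidef_outer (v : EuclideanSpace 𝕜 (Fin n)) : (outer v).PosSemidef :=
  Matrix.posSemidef_vecMulVec_self_star _

theorem exists_eq_sum_outer {X : Matrix (Fin n) (Fin n) 𝕜} (hX : X.PosSemidef) :
    ∃ (l : ℕ) (b : Fin l → EuclideanSpace 𝕜 (Fin n)), X = ∑ k, outer (b k) := by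
  obtain ⟨l, b, hb⟩ := Matrix.posSemidef_iff_eq_sum_vecMulVec.1 hX
  exact ⟨l, fun k => WithLp.toLp 2 (b k), hb⟩

theorem re_trace_sum {ι : Type*} (s : Finset ι) (X : ι → Matrix (Fin n) (Fin n) 𝕜) :
    RCLike.re (∑ k ∈ s, X k).trace = ∑ k ∈ s, RCLike.re (X k).trace := by
  rw [Matrix.trace_sum, map_sum]

theorem frobeniusNorm_sum_le {ι : Type*} (s : Finset ι) (X : ι → Matrix (Fin n) (Fin n) 𝕜) :
    frobeniusNorm (∑ k ∈ s, X k) ≤ ∑ k ∈ s, frobeniusNorm (X k) := by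
  simp only [frobeniusNorm_eq_norm_entries, entries_sum]
  exact norm_sum_le _ _

theorem frobeniusNorm_outer (v : EuclideanSpace 𝕜 (Fin n)) :
    frobeniusNorm (outer v) = ‖v‖ ^ 2 := by
  rw [frobeniusNorm_eq_norm_entries, outer_eq_outerProd, norm_entries_outerProd, sq]

/-- For rank-one pieces norm and trace agree; the triangle inequality does the rest. -/
theorem frobeniusNorm_le_re_trace {X : Matrix (Fin n) (Fin n) 𝕜} (hX : X.PosSemidef) :
    frobeniusNorm X ≤ RCLike.re X.trace := by
  obtain ⟨l, b, rfl⟩ := exists_eq_sum_outer hX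
  rw [re_trace_sum]
  refine (frobeniusNorm_sum_le _ _).trans_eq ?_
  simp only [frobeniusNorm_outer, re_trace_outer]

/-- The block decomposition, relative to a unit vector `e`, of the difference of a positive
semidefinite matrix and a multiple of `e e^*`. -/
theorem exists_block_decomposition {X : Matrix (Fin n) (Fin n) 𝕜} (hX : X.PosSemidef)
    {e : EuclideanSpace 𝕜 (Fin n)} (he : ‖e‖ = 1) (r : ℝ) :
    ∃ (s : ℝ) (v : EuclideanSpace 𝕜 (Fin n)) (l : ℕ) (w : Fin l → EuclideanSpace 𝕜 (Fin n)),
      inner 𝕜 e v = 0 ∧ (∀ k, inner 𝕜 e (w k) = 0) ∧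
      X - outer (((r : ℝ) : 𝕜) • e) =
        ((-s : ℝ) : 𝕜) • outer e + (outerProd e v + outerProd v e) + ∑ k, outer (w k) ∧
      RCLike.re X.trace = r ^ 2 - s + ∑ k, ‖w k‖ ^ 2 := by
  obtain ⟨l, b, hb⟩ := exists_eq_sum_outer hX
  -- Each vector of X = ∑ b_k b_k^* is split as b_k = α_k e + w_k with w_k orthogonal to e, and the
  -- products are collected.
  set α : Fin l → 𝕜 := fun k => inner 𝕜 e (b k) with hα
  set w : Fin l → EuclideanSpace 𝕜 (Fin n) := fun k => b k - α k • e with hw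
  set v : EuclideanSpace 𝕜 (Fin n) := ∑ k, starRingEnd 𝕜 (α k) • w k with hv
  set s : ℝ := r ^ 2 - ∑ k, ‖α k‖ ^ 2 with hs
  have hwe : ∀ k, inner 𝕜 e (w k) = 0 := by
    intro k
    simp only [hw, hα, inner_sub_right, inner_smul_right, inner_self_eq_norm_sq_to_K, he]
    simp
  have hve : inner 𝕜 e v = 0 := by
    simp [hv, inner_sum, inner_smul_right, hwe]
  have hbk : ∀ k, outer (b k) = ((‖α k‖ ^ 2 : ℝ) : 𝕜) • outer e +
      (outerProd e (starRingEnd 𝕜 (α k) • w k) + outerProd (starRingEnd 𝕜 (α k) • w k) e) +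
        outer (w k) := by
    intro k
    have hbw : b k = α k • e + w k := by simp [hw]
    ext i j
    rw [hbw]
    simp only [outer_eq_outerProd, outerProd_apply, Matrix.add_apply, Matrix.smul_apply,
      PiLp.smul_apply, PiLp.add_apply, smul_eq_mul, map_mul, map_add, RCLike.conj_conj,
      RCLike.ofReal_pow, ← RCLike.mul_conj]
    ring
  have hXeq : X - outer (((r : ℝ) : 𝕜) • e) =
        ((-s : ℝ) : 𝕜) • outer e + (outerProd e v + outerProd v e) + ∑ k, outer (w k) := by
    have h1 : outerProd e v = ∑ k, outerProd e (starRingEnd 𝕜 (α k) • w k) := by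
      ext i j
      simp only [hv, outerProd_apply, Matrix.sum_apply, WithLp.ofLp_sum, Finset.sum_apply, map_sum,
        Finset.mul_sum]
    have h2 : outerProd v e = ∑ k, outerProd (starRingEnd 𝕜 (α k) • w k) e := by
      ext i j
      simp only [hv, outerProd_apply, Matrix.sum_apply, WithLp.ofLp_sum, Finset.sum_apply,
        Finset.sum_mul]
    rw [hb, Finset.sum_congr rfl fun k _ => hbk k, Finset.sum_add_distrib, Finset.sum_add_distrib,
      Finset.sum_add_distrib, ← h1, ← h2, ← Finset.sum_smul, outer_smul, RCLike.norm_ofReal, sq_abs,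
      ← RCLike.ofReal_sum]
    have h3 : (-s : ℝ) = ∑ k, ‖α k‖ ^ 2 - r ^ 2 := by rw [hs]; ring
    rw [h3, RCLike.ofReal_sub, sub_smul]
    abel
  refine ⟨s, v, l, w, hve, hwe, hXeq, ?_⟩
  have htr := congrArg (fun Y : Matrix (Fin n) (Fin n) 𝕜 => RCLike.re Y.trace) hXeq
  have hev : inner 𝕜 v e = 0 := inner_eq_zero_symm.1 hve
  simp only [Matrix.trace_sub, Matrix.trace_add, Matrix.trace_smul, map_add, map_sub, smul_eq_mul,
    RCLike.re_ofReal_mul, re_trace_outer, re_trace_sum, trace_outerProd, hve, hev, map_zero, he,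
    norm_smul, RCLike.norm_ofReal, mul_one, sq_abs, one_pow] at htr
  linarith

end Matrices

/-! ### The deterministic recovery inequality. -/

section Recovery

variable {𝕜 : Type} [RCLike 𝕜] {n m : ℕ}

/-- On a regular sample, the measurements of `X - r² e e^*` control its Frobenius norm for all
positive semidefinite `X` with trace at most `r²`. -/
theorem frobeniusNorm_le_of_isRegularSample {a b : ℝ} (hb : 0 ≤ b) (hab : b + 1 / 2 ^ 31 ≤ a)
    {e : EuclideanSpace 𝕜 (Fin n)} (he : ‖e‖ = 1) {z : Fin m → EuclideanSpace 𝕜 (Fin n)}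
    (hz : IsRegularSample a b (1 / 2 ^ 18) (1 / 2 ^ 54) e z)
    {X : Matrix (Fin n) (Fin n) 𝕜} (hX : X.PosSemidef) {r : ℝ}
    (htr : RCLike.re X.trace ≤ r ^ 2) :
    m * frobeniusNorm (X - outer (((r : ℝ) : 𝕜) • e)) ≤
      2 ^ 58 * ∑ i, |quadForm (X - outer (((r : ℝ) : 𝕜) • e)) (z i)| := by
  obtain ⟨s, v, l, w, hev, hew, hH, htrace⟩ := exists_block_decomposition hX he r
  set H := X - outer (((r : ℝ) : 𝕜) • e) with hHdef
  set p : ℝ := ∑ k, ‖w k‖ ^ 2 with hp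
  have hp0 : 0 ≤ p := Finset.sum_nonneg fun k _ => sq_nonneg _
  have hps : p ≤ s := by linarith
  have hs0 : 0 ≤ s := hp0.trans hps
  have hm : (0 : ℝ) ≤ m := Nat.cast_nonneg m
  set Q : ℝ := ∑ i, |quadForm H (z i)| with hQ
  have hquad : ∀ y, quadForm H y =
      -s * sqInner e y + 2 * crossRe e v y + ∑ k, sqInner (w k) y := by
    intro y
    rw [hH, quadForm_add, quadForm_add, quadForm_add, quadForm_real_smul, quadForm_sum,
      quadForm_outerProd, quadForm_outerProd, crossRe_comm v e]
    simp only [quadForm_outer]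
    ring
  have hfrob : frobeniusNorm H ≤ 2 * s + 2 * ‖v‖ := by
    rw [frobeniusNorm_eq_norm_entries, hH, entries_add, entries_add, entries_add, entries_smul,
      entries_sum]
    have h1 : ‖((-s : ℝ) : 𝕜) • entries (outer e)‖ = s := by
      rw [norm_smul, outer_eq_outerProd, norm_entries_outerProd, he, RCLike.norm_ofReal, abs_neg,
        abs_of_nonneg hs0]
      ring
    have h2 : ‖∑ k, entries (outer (w k))‖ ≤ p := by
      refine (norm_sum_le _ _).trans_eq (Finset.sum_congr rfl fun k _ => ?_)
      rw [outer_eq_outerProd, norm_entries_outerProd, sq]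
    have h3 : ‖entries (outerProd e v)‖ = ‖v‖ := by rw [norm_entries_outerProd, he, one_mul]
    have h4 : ‖entries (outerProd v e)‖ = ‖v‖ := by rw [norm_entries_outerProd, he, mul_one]
    have h5 := norm_add_le (((-s : ℝ) : 𝕜) • entries (outer e) +
      (entries (outerProd e v) + entries (outerProd v e))) (∑ k, entries (outer (w k)))
    have h6 := norm_add_le (((-s : ℝ) : 𝕜) • entries (outer e))
      (entries (outerProd e v) + entries (outerProd v e))
    have h7 := norm_add_le (entries (outerProd e v)) (entries (outerProd v e))
    linarith
  have hweighted : -Q ≤ -s * ∑ i, weight e (z i) * sqInner e (z i) +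
      2 * ∑ i, weight e (z i) * crossRe e v (z i) +
      ∑ k, ∑ i, weight e (z i) * sqInner (w k) (z i) := by
    have h1 : -s * ∑ i, weight e (z i) * sqInner e (z i) +
        2 * ∑ i, weight e (z i) * crossRe e v (z i) +
        ∑ k, ∑ i, weight e (z i) * sqInner (w k) (z i) =
        ∑ i, weight e (z i) * quadForm H (z i) := by
      rw [Finset.sum_comm, Finset.mul_sum, Finset.mul_sum, ← Finset.sum_add_distrib,
        ← Finset.sum_add_distrib]
      refine Finset.sum_congr rfl fun i _ => ?_
      rw [hquad, mul_add, Finset.mul_sum]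
      ring
    rw [h1, hQ, ← Finset.sum_neg_distrib]
    refine Finset.sum_le_sum fun i _ => ?_
    exact (abs_le.1 (abs_weight_mul_le e (z i) (quadForm H (z i)))).1
  have habs : 2 * ∑ i, |crossRe e v (z i)| ≤
      Q + s * ∑ i, sqInner e (z i) + ∑ k, ∑ i, sqInner (w k) (z i) := by
    rw [Finset.sum_comm, hQ, Finset.mul_sum, Finset.mul_sum, ← Finset.sum_add_distrib,
      ← Finset.sum_add_distrib]
    refine Finset.sum_le_sum fun i _ => ?_
    have h1 : 0 ≤ ∑ k, sqInner (w k) (z i) := Finset.sum_nonneg fun k _ => sqInner_nonneg _ _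
    have h2 : 0 ≤ s * sqInner e (z i) := mul_nonneg hs0 (sqInner_nonneg _ _)
    have h3 : 2 * crossRe e v (z i) =
        quadForm H (z i) + s * sqInner e (z i) - ∑ k, sqInner (w k) (z i) := by
      rw [hquad]
      ring
    have h4 : 2 * |crossRe e v (z i)| = |2 * crossRe e v (z i)| := by
      rw [abs_mul, abs_of_pos (two_pos : (0 : ℝ) < 2)]
    rw [h4, h3]
    refine abs_le.2 ⟨?_, ?_⟩
    · linarith [neg_abs_le (quadForm H (z i))]
    · linarith [le_abs_self (quadForm H (z i))]
  have hw1 : ∑ k, ∑ i, weight e (z i) * sqInner (w k) (z i) ≤ m * (b + 1 / 2 ^ 54) * p := by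
    rw [hp, Finset.mul_sum]
    exact Finset.sum_le_sum fun k _ => hz.weight_orth (w k) (hew k)
  have hw2 : ∑ k, ∑ i, sqInner (w k) (z i) ≤ 2 * m * p := by
    rw [hp, Finset.mul_sum]
    exact Finset.sum_le_sum fun k _ => hz.sum_orth (w k) (hew k)
  have hself := mul_le_mul_of_nonneg_left hz.weight_self hs0
  have hself2 := mul_le_mul_of_nonneg_left hz.sum_self hs0
  have hcross := (abs_le.1 (hz.weight_cross v hev)).2
  have hlow := hz.abs_cross v hev
  set V := m * ‖v‖ with hV
  set T := m * s with hT
  have hV0 : 0 ≤ V := by positivity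
  have hT0 : 0 ≤ T := by positivity
  have hmp : (m : ℝ) * p ≤ T := by rw [hT]; gcongr
  have hupper : ∑ k, ∑ i, weight e (z i) * sqInner (w k) (z i) ≤ (b + 1 / 2 ^ 54) * T := by
    have h : 0 ≤ b + 1 / 2 ^ 54 := by positivity
    calc _ ≤ m * (b + 1 / 2 ^ 54) * p := hw1
      _ = (b + 1 / 2 ^ 54) * (m * p) := by ring
      _ ≤ _ := by gcongr
  -- The gap a - b ≥ 2^-31 loses 2^-54 twice, in `weight_self` and in `weight_orth`, and stays above
  -- 2^-32; twice the cross-term error is 2^-53 V.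
  have hT1 : 1 / 2 ^ 32 * T ≤ Q + 1 / 2 ^ 53 * V := by
    have h1 : (b + 1 / 2 ^ 31) * T ≤ a * T := by gcongr
    have h2 : s * (m * (a - 1 / 2 ^ 54)) = (a - 1 / 2 ^ 54) * T := by rw [hT]; ring
    have h3 : (m : ℝ) * (1 / 2 ^ 54) * ‖v‖ = 1 / 2 ^ 54 * V := by rw [hV]; ring
    rw [h2] at hself
    rw [h3] at hcross
    linarith
  have hV1 : 1 / 2 ^ 19 * V ≤ Q + 4 * T := by
    have h3 : (m : ℝ) * (1 / 2 ^ 18 - 1 / 2 ^ 54) * ‖v‖ = (1 / 2 ^ 18 - 1 / 2 ^ 54) * V := by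
      rw [hV]; ring
    have h4 : s * (2 * m) = 2 * T := by rw [hT]; ring
    rw [h3] at hlow
    rw [h4] at hself2
    linarith
  -- Alone, `hT1` and `hV1` are exactly borderline, as 2^19 · 4 / 2^53 = 2^-32. The slack comes from
  -- the sharper bound 2 (2^-18 - 2^-54) V ≤ Q + 4 T contained in `hlow`, `habs`, `hself2`, `hw2`
  -- and `hmp`.
  calc m * frobeniusNorm H ≤ m * (2 * s + 2 * ‖v‖) := by gcongr
    _ = 2 * T + 2 * V := by rw [hT, hV]; ring
    _ ≤ _ := by linarith

end Recovery

/-! ### The convex program and extraction of the vector. -/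

section Program

variable {𝕜 : Type} [RCLike 𝕜] {n m : ℕ}

theorem measure_apply (z : Fin m → EuclideanSpace 𝕜 (Fin n)) (X : Matrix (Fin n) (Fin n) 𝕜)
    (i : Fin m) : measure z X i = quadForm X (z i) := rfl

theorem measure_sub_noisyData (z : Fin m → EuclideanSpace 𝕜 (Fin n))
    (x : EuclideanSpace 𝕜 (Fin n)) (ν : EuclideanSpace ℝ (Fin m))
    (X : Matrix (Fin n) (Fin n) 𝕜) :
    measure z X - noisyData z x ν = measure z (X - outer x) - ν := by
  ext i
  rw [PiLp.sub_apply, PiLp.sub_apply, measure_apply, measure_apply, quadForm_sub, quadForm_outer]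
  change _ - (sqInner x (z i) + ν i) = _
  ring

theorem isFeasible_outer (z : Fin m → EuclideanSpace 𝕜 (Fin n)) (x : EuclideanSpace 𝕜 (Fin n))
    {ν : EuclideanSpace ℝ (Fin m)} {ε : ℝ} (hν : ‖ν‖ ≤ ε) :
    IsFeasible z (noisyData z x ν) ε (outer x) := by
  refine ⟨posSemidef_outer x, ?_⟩
  have h : measure z (outer x - outer x) = 0 := by
    ext i
    rw [measure_apply, quadForm_sub, sub_self]
    rfl
  rwa [measure_sub_noisyData, h, zero_sub, norm_neg]

theorem continuous_measure (z : Fin m → EuclideanSpace 𝕜 (Fin n)) :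
    Continuous (measure (𝕜 := 𝕜) z) := by
  refine (PiLp.continuous_toLp 2 _).comp (continuous_pi fun i => RCLike.continuous_re.comp ?_)
  exact Continuous.dotProduct continuous_const (Continuous.matrix_mulVec continuous_id
    continuous_const)

theorem continuous_re_trace :
    Continuous fun X : Matrix (Fin n) (Fin n) 𝕜 => RCLike.re X.trace :=
  RCLike.continuous_re.comp continuous_id.matrix_trace

theorem isClosed_posSemidef : IsClosed {X : Matrix (Fin n) (Fin n) 𝕜 | X.PosSemidef} := by
  simp only [Matrix.posSemidef_iff_dotProduct_mulVec, Matrix.IsHermitian, Set.ofPred_and,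
    Set.ofPred_forall]
  refine (isClosed_eq continuous_id.matrix_conjTranspose continuous_id).inter
    (isClosed_iInter fun x => isClosed_le continuous_const ?_)
  exact Continuous.dotProduct continuous_const (Continuous.matrix_mulVec continuous_id
    continuous_const)

theorem norm_apply_le_frobeniusNorm (X : Matrix (Fin n) (Fin n) 𝕜) (i j : Fin n) :
    ‖X i j‖ ≤ frobeniusNorm X := by
  rw [frobeniusNorm_eq_norm_entries]
  exact PiLp.norm_apply_le (entries X) (i, j)

/-- Only feasible points of trace at most that of `Y` matter; they form a compact set, the trace
bounding the Frobenius norm on positive semidefinite matrices. -/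
theorem exists_isSolution (z : Fin m → EuclideanSpace 𝕜 (Fin n)) (b : EuclideanSpace ℝ (Fin m))
    (ε : ℝ) {Y : Matrix (Fin n) (Fin n) 𝕜} (hY : IsFeasible z b ε Y) :
    ∃ X, IsSolution z b ε X := by
  set R : ℝ := RCLike.re Y.trace with hR
  set S : Set (Matrix (Fin n) (Fin n) 𝕜) :=
    ({X | X.PosSemidef} ∩ {X | ‖measure z X - b‖ ≤ ε}) ∩ {X | RCLike.re X.trace ≤ R} with hS
  have hSclosed : IsClosed S :=
    (isClosed_posSemidef.inter (isClosed_le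
      ((continuous_measure z).sub continuous_const).norm continuous_const)).inter
      (isClosed_le continuous_re_trace continuous_const)
  have hcomp : IsCompact (Set.univ.pi fun _ : Fin n => Set.univ.pi fun _ : Fin n =>
      Metric.closedBall (0 : 𝕜) R) :=
    isCompact_univ_pi fun _ => isCompact_univ_pi fun _ => isCompact_closedBall _ _
  have hSsub : S ⊆ (Set.univ.pi fun _ : Fin n => Set.univ.pi fun _ : Fin n =>
      Metric.closedBall (0 : 𝕜) R) := by
    rintro X ⟨⟨hX, -⟩, hXR⟩ i - j -
    rw [mem_closedBall_zero_iff]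
    exact (norm_apply_le_frobeniusNorm X i j).trans ((frobeniusNorm_le_re_trace hX).trans hXR)
  have hScomp : IsCompact S := hcomp.of_isClosed_subset hSclosed hSsub
  obtain ⟨X, ⟨hXf, hXR⟩, hmin⟩ := hScomp.exists_isMinOn ⟨Y, hY, le_refl R⟩
    continuous_re_trace.continuousOn
  refine ⟨X, hXf, fun Z hZ => ?_⟩
  rcases le_total (RCLike.re Z.trace) R with h | h
  · exact hmin ⟨hZ, h⟩
  · exact le_trans hXR h

theorem sum_abs_le_sqrt_mul_norm (y : EuclideanSpace ℝ (Fin m)) :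
    ∑ i, |y i| ≤ Real.sqrt m * ‖y‖ := by
  have h := Finset.sum_mul_sq_le_sq_mul_sq Finset.univ (fun _ : Fin m => (1 : ℝ)) fun i => |y i|
  refine le_of_sq_le_sq ?_ (by positivity)
  rw [mul_pow, Real.sq_sqrt (Nat.cast_nonneg _), EuclideanSpace.norm_sq_eq]
  simpa using h

/-- The distance of two vectors up to a phase is controlled by the distance of their outer
products. -/
theorem exists_phase_norm_sub_le (v x : EuclideanSpace 𝕜 (Fin n)) :
    ∃ c : 𝕜, ‖c‖ = 1 ∧ ‖v - c • x‖ * ‖x‖ ≤ 2 * frobeniusNorm (outer v - outer x) := by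
  -- The optimal phase makes c⟨v, x⟩ real and nonnegative, so both sides become polynomials in ‖v‖,
  -- ‖x‖ and ρ = |⟨v, x⟩|.
  obtain ⟨c, hc, hcv⟩ : ∃ c : 𝕜, ‖c‖ = 1 ∧
      RCLike.re (c * inner 𝕜 v x) = ‖(inner 𝕜 v x : 𝕜)‖ := by
    rcases eq_or_ne (inner 𝕜 v x : 𝕜) 0 with h | h
    · exact ⟨1, norm_one, by simp [h]⟩
    · have hn : ‖(inner 𝕜 v x : 𝕜)‖ ≠ 0 := norm_ne_zero_iff.2 h
      refine ⟨((‖(inner 𝕜 v x : 𝕜)‖⁻¹ : ℝ) : 𝕜) * starRingEnd 𝕜 (inner 𝕜 v x), ?_, ?_⟩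
      · rw [norm_mul, RCLike.norm_conj, RCLike.norm_ofReal, abs_of_nonneg (by positivity)]
        exact inv_mul_cancel₀ hn
      · rw [mul_assoc, RCLike.conj_mul, RCLike.re_ofReal_mul, ← RCLike.ofReal_pow,
          RCLike.ofReal_re]
        field_simp
  refine ⟨c, hc, le_of_sq_le_sq ?_ (by
    rw [frobeniusNorm_eq_norm_entries]
    positivity)⟩
  set ρ := ‖(inner 𝕜 v x : 𝕜)‖ with hρ
  have h1 : ‖v - c • x‖ ^ 2 = ‖v‖ ^ 2 - 2 * ρ + ‖x‖ ^ 2 := by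
    rw [norm_sub_sq (𝕜 := 𝕜), inner_smul_right, hcv, norm_smul, hc, one_mul]
  have h2 : frobeniusNorm (outer v - outer x) ^ 2 = ‖v‖ ^ 4 - 2 * ρ ^ 2 + ‖x‖ ^ 4 := by
    rw [frobeniusNorm_eq_norm_entries, entries_sub, norm_sub_sq (𝕜 := 𝕜), outer_eq_outerProd,
      outer_eq_outerProd, norm_entries_outerProd, norm_entries_outerProd, inner_entries_outerProd,
      ← inner_conj_symm x v, RCLike.mul_conj, ← RCLike.ofReal_pow, RCLike.ofReal_re]
    ring
  have hρ0 : 0 ≤ ρ := norm_nonneg _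
  have hρ1 : ρ ≤ ‖v‖ * ‖x‖ := norm_inner_le_norm v x
  rw [mul_pow, mul_pow, h1, h2]
  have hv0 := norm_nonneg v
  have hx0 := norm_nonneg x
  set p := ‖v‖
  set q := ‖x‖
  -- The first identity expands about the Cauchy–Schwarz equality case ρ = p q, the second about ρ =
  -- 0; the case split gives the sign of the respective remainder.
  rcases le_total (q ^ 2) (4 * (p * q) + 4 * ρ) with h | h
  · have e1 : 4 * (p ^ 4 - 2 * ρ ^ 2 + q ^ 4) - (p ^ 2 - 2 * ρ + q ^ 2) * q ^ 2 =
        (p - q) ^ 2 * (4 * p ^ 2 + 8 * p * q + 3 * q ^ 2) +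
          2 * ((p * q - ρ) * (4 * (p * q) + 4 * ρ - q ^ 2)) := by ring
    have e2 : 0 ≤ (p - q) ^ 2 * (4 * p ^ 2 + 8 * p * q + 3 * q ^ 2) := by positivity
    have e3 : 0 ≤ (p * q - ρ) * (4 * (p * q) + 4 * ρ - q ^ 2) :=
      mul_nonneg (by linarith) (by linarith)
    linarith
  · have e1 : 4 * (p ^ 4 - 2 * ρ ^ 2 + q ^ 4) - (p ^ 2 - 2 * ρ + q ^ 2) * q ^ 2 =
        (2 * p ^ 2 - q ^ 2 / 4) ^ 2 + 47 / 16 * q ^ 4 + 2 * (ρ * (q ^ 2 - 4 * ρ)) := by ring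
    have e3 : 0 ≤ ρ * (q ^ 2 - 4 * ρ) :=
      mul_nonneg hρ0 (by linarith [mul_nonneg hv0 hx0])
    have e4 : 0 ≤ (2 * p ^ 2 - q ^ 2 / 4) ^ 2 + 47 / 16 * q ^ 4 := by positivity
    linarith

/-- If `X` has trace at most `‖x‖²`, its top component recovers `x` up to a phase, with an error
controlled by the Frobenius distance of `X` and `x x^*`. -/
theorem exists_phase_of_isTopComponent {X : Matrix (Fin n) (Fin n) 𝕜}
    {x v : EuclideanSpace 𝕜 (Fin n)} (htr : RCLike.re X.trace ≤ ‖x‖ ^ 2)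
    (hv : IsTopComponent X v) :
    ∃ c : 𝕜, ‖c‖ = 1 ∧ ‖v - c • x‖ ≤ 2 * ‖x‖ ∧
      ‖v - c • x‖ * ‖x‖ ≤ 4 * frobeniusNorm (X - outer x) := by
  obtain ⟨u, lam, hanti, hlam, hX, k₀, hk₀, rfl⟩ := hv
  obtain ⟨c, hc, hle⟩ := exists_phase_norm_sub_le (((Real.sqrt (lam k₀) : ℝ) : 𝕜) • u k₀) x
  set v := ((Real.sqrt (lam k₀) : ℝ) : 𝕜) • u k₀ with hv
  have hlam0 : ∀ k, lam k ≤ lam k₀ := fun k => hanti (Fin.le_def.2 (by omega))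
  have htrX : RCLike.re X.trace = ∑ k, lam k := by
    rw [hX, re_trace_sum]
    refine Finset.sum_congr rfl fun k _ => ?_
    rw [Matrix.trace_smul, smul_eq_mul, RCLike.re_ofReal_mul, re_trace_outer, u.norm_eq_one]
    ring
  have houter : outer v = ((lam k₀ : ℝ) : 𝕜) • outer (u k₀) := by
    rw [hv, outer_smul, RCLike.norm_ofReal, sq_abs, Real.sq_sqrt (hlam k₀)]
  have hsplit : ∑ k, lam k = lam k₀ + ∑ k ∈ Finset.univ.erase k₀, lam k :=
    (Finset.add_sum_erase _ _ (Finset.mem_univ k₀)).symm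
  have htail0 : 0 ≤ ∑ k ∈ Finset.univ.erase k₀, lam k := Finset.sum_nonneg fun k _ => hlam k
  have hnormv : ‖v‖ ≤ ‖x‖ := by
    refine le_of_sq_le_sq ?_ (norm_nonneg x)
    have : ‖v‖ ^ 2 = lam k₀ := by
      rw [hv, norm_smul, u.norm_eq_one, RCLike.norm_ofReal, mul_one, sq_abs,
        Real.sq_sqrt (hlam k₀)]
    linarith
  refine ⟨c, hc, ?_, hle.trans ?_⟩
  · have := norm_sub_le v (c • x)
    have h1 : ‖c • x‖ = ‖x‖ := by rw [norm_smul, hc, one_mul]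
    linarith
  have hdiff : frobeniusNorm (X - outer v) ≤ ∑ k ∈ Finset.univ.erase k₀, lam k := by
    have h1 : X - outer v = ∑ k ∈ Finset.univ.erase k₀, ((lam k : ℝ) : 𝕜) • outer (u k) := by
      rw [houter, hX, ← Finset.add_sum_erase _ _ (Finset.mem_univ k₀), add_sub_cancel_left]
    rw [h1]
    refine (frobeniusNorm_sum_le _ _).trans_eq (Finset.sum_congr rfl fun k _ => ?_)
    rw [frobeniusNorm_eq_norm_entries, entries_smul, norm_smul, ← frobeniusNorm_eq_norm_entries,
      frobeniusNorm_outer, u.norm_eq_one, RCLike.norm_ofReal, abs_of_nonneg (hlam k)]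
    ring
  -- The tail is Tr X minus the top eigenvalue, hence at most ‖x‖² - lam k₀; testing X on x shows
  -- that the top eigenvalue is at least ‖x‖² - ‖X - x x^*‖_F.
  have htail : ∑ k ∈ Finset.univ.erase k₀, lam k ≤ frobeniusNorm (X - outer x) := by
    rcases eq_or_ne x 0 with rfl | hx
    · have h1 : 0 ≤ frobeniusNorm (X - outer (0 : EuclideanSpace 𝕜 (Fin n))) := by
        rw [frobeniusNorm_eq_norm_entries]
        exact norm_nonneg _
      rw [norm_zero] at htr
      linarith [hlam k₀]
    · have hx0 : 0 < ‖x‖ ^ 2 := by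
        have := norm_pos_iff.2 hx
        positivity
      have h1 : quadForm X x ≤ lam k₀ * ‖x‖ ^ 2 := by
        rw [hX, quadForm_sum, ← sum_sqInner_basis u x, Finset.mul_sum]
        refine Finset.sum_le_sum fun k _ => ?_
        rw [quadForm_real_smul, quadForm_outer]
        exact mul_le_mul_of_nonneg_right (hlam0 k) (sqInner_nonneg _ _)
      have h2 := (abs_le.1 (abs_quadForm_le (X - outer x) x)).1
      have h3 : quadForm (outer x) x = ‖x‖ ^ 2 * ‖x‖ ^ 2 := by
        rw [quadForm_outer, sqInner, inner_self_eq_norm_sq_to_K, norm_pow, RCLike.norm_ofReal,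
          abs_of_nonneg (norm_nonneg x)]
        ring
      rw [quadForm_sub, h3] at h2
      have h4 : (‖x‖ ^ 2 - frobeniusNorm (X - outer x)) * ‖x‖ ^ 2 ≤ lam k₀ * ‖x‖ ^ 2 := by
        linarith
      have h5 := le_of_mul_le_mul_right h4 hx0
      linarith
  have htri : frobeniusNorm (outer v - outer x) ≤
      frobeniusNorm (X - outer v) + frobeniusNorm (X - outer x) := by
    simp only [frobeniusNorm_eq_norm_entries, entries_sub]
    have h1 : entries (outer v) - entries (outer x) =
        (entries X - entries (outer x)) - (entries X - entries (outer v)) := by abel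
    rw [h1, add_comm]
    exact norm_sub_le _ _
  linarith

/-- A Frobenius norm bound in terms of the measurements for all competitors of trace at most
`‖x‖²` implies stable recovery. -/
theorem stableRecovery_of_frobeniusNorm_le {C : ℝ} (hC : 1 ≤ C) (hm : 1 ≤ m)
    {z : Fin m → EuclideanSpace 𝕜 (Fin n)} {x : EuclideanSpace 𝕜 (Fin n)}
    (h : ∀ X : Matrix (Fin n) (Fin n) 𝕜, X.PosSemidef → RCLike.re X.trace ≤ ‖x‖ ^ 2 →
      m * frobeniusNorm (X - outer x) ≤ C * ∑ i, |quadForm (X - outer x) (z i)|) :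
    StableRecovery (8 * C) z x := by
  intro ε ν hν
  have hε : 0 ≤ ε := (norm_nonneg ν).trans hν
  have hfeas := isFeasible_outer z x hν
  refine ⟨exists_isSolution z _ ε hfeas, fun X hX => ?_⟩
  have htr : RCLike.re X.trace ≤ ‖x‖ ^ 2 := (hX.2 _ hfeas).trans_eq (re_trace_outer x)
  have hm1 : (1 : ℝ) ≤ m := by exact_mod_cast hm
  have hfrob : frobeniusNorm (X - outer x) ≤ 2 * C * ε := by
    have h1 := h X hX.1.1 htr
    have h2 : ‖measure z (X - outer x)‖ ≤ 2 * ε := by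
      have h3 := hX.1.2
      rw [measure_sub_noisyData] at h3
      have h4 := norm_add_le (measure z (X - outer x) - ν) ν
      rw [sub_add_cancel] at h4
      linarith
    have h3 : ∑ i, |quadForm (X - outer x) (z i)| ≤ m * (2 * ε) := by
      refine (sum_abs_le_sqrt_mul_norm (measure z (X - outer x))).trans ?_
      -- A factor 1 / √m is given away here; the statement asks only for a multiple of ε.
      have h5 : Real.sqrt m ≤ m := by
        rw [Real.sqrt_le_left (by linarith)]
        nlinarith
      gcongr
    have h4 : (m : ℝ) * frobeniusNorm (X - outer x) ≤ m * (2 * C * ε) := by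
      refine h1.trans ((mul_le_mul_of_nonneg_left h3 (by linarith)).trans_eq ?_)
      ring
    exact le_of_mul_le_mul_left h4 (by linarith)
  have hCε : 0 ≤ C * ε := by positivity
  refine ⟨hfrob.trans (by linarith), fun v hv => ?_⟩
  obtain ⟨c, hc, h1, h2⟩ := exists_phase_of_isTopComponent htr hv
  refine ⟨c, hc, ?_⟩
  have hx0 := norm_nonneg x
  rcases eq_or_ne x 0 with rfl | hx
  · rw [norm_zero] at h1 ⊢
    simpa using h1
  · have hxpos : 0 < ‖x‖ := norm_pos_iff.2 hx
    rw [mul_min_of_nonneg _ _ (by linarith)]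
    refine le_min (h1.trans (by nlinarith)) ?_
    rw [← mul_div_assoc, le_div_iff₀ hxpos]
    linarith

/-- The zero vector is recovered from all sensing vectors. -/
theorem stableRecovery_zero {C : ℝ} (hC : 0 ≤ C) (z : Fin m → EuclideanSpace 𝕜 (Fin n)) :
    StableRecovery C z 0 := by
  intro ε ν hν
  have hε : 0 ≤ ε := (norm_nonneg ν).trans hν
  have hfeas := isFeasible_outer z (0 : EuclideanSpace 𝕜 (Fin n)) hν
  refine ⟨exists_isSolution z _ ε hfeas, fun X hX => ?_⟩
  have htr : RCLike.re X.trace ≤ ‖(0 : EuclideanSpace 𝕜 (Fin n))‖ ^ 2 :=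
    (hX.2 _ hfeas).trans_eq (re_trace_outer 0)
  have hout : outer (0 : EuclideanSpace 𝕜 (Fin n)) = 0 := by
    ext i j
    simp [outer_eq_outerProd, outerProd_apply]
  refine ⟨?_, fun v hv => ?_⟩
  · have h1 := (frobeniusNorm_le_re_trace hX.1.1).trans htr
    rw [norm_zero] at h1
    rw [hout, sub_zero]
    have : 0 ≤ C * ε := by positivity
    linarith
  · obtain ⟨c, hc, h1, -⟩ := exists_phase_of_isTopComponent htr hv
    refine ⟨c, hc, ?_⟩
    rw [norm_zero] at h1 ⊢
    simpa using h1

end Program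

/-! ### Assembling the probability bound. -/

section Probability

theorem isProbabilityMeasure_sensingLaw {𝕜 : Type} [RCLike 𝕜] {n m : ℕ} (hn : 1 ≤ n) :
    IsProbabilityMeasure (sensingLaw 𝕜 n m) := by
  have := isProbabilityMeasure_uniformSphere (𝕜 := 𝕜) hn
  unfold sensingLaw
  infer_instance

/-- Stable recovery with high probability, for both scalar fields simultaneously. -/
theorem exists_stableRecovery :
    ∃ γ C : ℝ, 0 < γ ∧ 0 < C ∧ ∀ (𝕜 : Type) [RCLike 𝕜] (n m : ℕ), 1 ≤ n →
      ∀ x : EuclideanSpace 𝕜 (Fin n), HoldsWithProbAtLeast (sensingLaw 𝕜 n m)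
        (1 - 3 * Real.exp (-(γ * ((m : ℝ) / (n : ℝ))))) fun z => StableRecovery C z x := by
  obtain ⟨K, γ, hK, hγ, h⟩ := exists_isRegularSample (θ := 1 / 2 ^ 54) (by positivity)
  -- With rate at most K⁻¹, the case m < K n has exponent at least -1, and 3 exp(-1) ≥ 1 makes the
  -- required probability nonpositive: the empty event serves.
  refine ⟨min γ K⁻¹, 8 * 2 ^ 58, by positivity, by positivity, fun 𝕜 _ n m hn x => ?_⟩
  have hprob := isProbabilityMeasure_sensingLaw (𝕜 := 𝕜) (m := m) hn
  have hn1 : (1 : ℝ) ≤ n := by exact_mod_cast hn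
  have hn0 : (0 : ℝ) < n := by linarith
  have hm0 : (0 : ℝ) ≤ m := Nat.cast_nonneg m
  rcases lt_or_ge (m : ℝ) (K * n) with hm | hm
  · refine ⟨∅, MeasurableSet.empty, fun z hz => absurd hz (Set.notMem_empty z), ?_⟩
    rw [ENNReal.ofReal_of_nonpos]
    · exact zero_le
    have h1 : min γ K⁻¹ * ((m : ℝ) / n) ≤ 1 := by
      calc min γ K⁻¹ * ((m : ℝ) / n) ≤ K⁻¹ * ((m : ℝ) / n) := by
            gcongr
            exact min_le_right _ _
        _ ≤ K⁻¹ * K := by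
            gcongr
            rw [div_le_iff₀ hn0]
            exact hm.le
        _ = 1 := inv_mul_cancel₀ hK.ne'
    have h2 : Real.exp (-1) ≤ Real.exp (-(min γ K⁻¹ * ((m : ℝ) / n))) :=
      Real.exp_le_exp.2 (by linarith)
    have h3 : 1 / 3 ≤ Real.exp (-1) := by
      rw [Real.exp_neg, ← one_div]
      exact one_div_le_one_div_of_le (Real.exp_pos 1) (by linarith [Real.exp_one_lt_d9])
    linarith
  rcases eq_or_ne x 0 with rfl | hx
  · refine ⟨Set.univ, MeasurableSet.univ, fun z _ => stableRecovery_zero (by positivity) z, ?_⟩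
    rw [measure_univ, ← ENNReal.ofReal_one]
    refine ENNReal.ofReal_le_ofReal ?_
    linarith [Real.exp_pos (-(min γ K⁻¹ * ((m : ℝ) / n)))]
  have hxpos : 0 < ‖x‖ := norm_pos_iff.2 hx
  set e : EuclideanSpace 𝕜 (Fin n) := ((‖x‖⁻¹ : ℝ) : 𝕜) • x with he
  have he1 : ‖e‖ = 1 := by
    rw [he, norm_smul, RCLike.norm_ofReal, abs_of_nonneg (by positivity)]
    exact inv_mul_cancel₀ hxpos.ne'
  have hxe : ((‖x‖ : ℝ) : 𝕜) • e = x := by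
    rw [he, smul_smul, ← RCLike.ofReal_mul, mul_inv_cancel₀ hxpos.ne', RCLike.ofReal_one, one_smul]
  obtain ⟨a, b, hb, hab, A, hAm, hA, hAp⟩ := h 𝕜 n m hn hm e he1
  have hm1 : 1 ≤ m := by
    have : (0 : ℝ) < m := lt_of_lt_of_le (by positivity) hm
    exact_mod_cast this
  refine ⟨A, hAm, fun z hz => ?_, le_trans (ENNReal.ofReal_le_ofReal ?_) hAp⟩
  · refine stableRecovery_of_frobeniusNorm_le (by norm_num) hm1 fun X hX htr => ?_
    have := frobeniusNorm_le_of_isRegularSample hb hab he1 (hA z hz) hX htr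
    rwa [hxe] at this
  -- The sampling event fails with probability at most exp(-γ m), which is less than is asked since
  -- m / n ≤ m.
  · have h1 : min γ K⁻¹ * ((m : ℝ) / n) ≤ γ * m := by
      have : (m : ℝ) / n ≤ m := div_le_self hm0 hn1
      gcongr
      exact min_le_left _ _
    have h2 : Real.exp (-(γ * m)) ≤ Real.exp (-(min γ K⁻¹ * ((m : ℝ) / n))) :=
      Real.exp_le_exp.2 (by linarith)
    linarith [Real.exp_pos (-(γ * m))]

end Probability

end PhaseLift
end

theorem theorem2 :
    ∃ c₀ γ C₀ : ℝ, 0 < c₀ ∧ 0 < γ ∧ 0 < C₀ ∧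
      ∀ n m : ℕ, 1 ≤ n → c₀ * ((n : ℝ) * Real.log (n : ℝ)) ≤ (m : ℝ) →
        (∀ x : EuclideanSpace ℝ (Fin n),
          PhaseLift.HoldsWithProbAtLeast (PhaseLift.sensingLaw ℝ n m)
            (1 - 3 * Real.exp (-(γ * ((m : ℝ) / (n : ℝ)))))
            (fun z => PhaseLift.StableRecovery C₀ z x)) ∧
        (∀ x : EuclideanSpace ℂ (Fin n),
          PhaseLift.HoldsWithProbAtLeast (PhaseLift.sensingLaw ℂ n m)
            (1 - 3 * Real.exp (-(γ * ((m : ℝ) / (n : ℝ)))))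
            (fun z => PhaseLift.StableRecovery C₀ z x)) := by
  obtain ⟨γ, C, hγ, hC, h⟩ := PhaseLift.exists_stableRecovery
  exact ⟨1, γ, C, one_pos, hγ, hC, fun n m hn _ => ⟨h ℝ n m hn, h ℂ n m hn⟩⟩
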